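/- **Setting.** Let $(\mathfrak H,J)$ be a Pontryagin space with negative index $\kappa$: $\mathfrak H$ is a complex Hilbert space, $J=J^*=J^{-1}$ is bounded, $\dim\ker(J+I)=\kappa<\infty$, and $[f,g]=(Jf,g)$. A linear relation in $\mathfrak H$ is a linear subspace $T\subseteq\mathfrak H\times\mathfrak H$; put $T^{-1}=\{\{g,f\}:\{f,g\}\in T\}$, $T-\lambda I=\{\{f,g-\lambda f\}:\{f,g\}\in T\}$, $T^{[*]}=\{\{h,k\}:[k,f]=[h,g]\ \text{for all }\{f,g\}\in T\}$, $T^{-[*]}=(T^{[*]})^{-1}$, $\rho(T)=\{\lambda\in\mathbb C:(T-\lambda I)^{-1}\text{ is (the graph of) a bounded everywhere defined operator}\}$, and $\sigma_p(T)=\{\lambda\in\mathbb C:\{f,\lambda f\}\in T\text{ for some }f\neq0\}$. Let $\mathbb D=\{|\lambda|<1\}$ and $\mathbb D_e=\{\lambda\in\mathbb C:|\lambda|>1\}$. Let $V$ be a closed (single-valued) isometric operator in $\mathfrak H$, identified with its graph, let $\mathfrak L_1,\mathfrak L_2$ be complex Hilbert spaces, $\mathfrak L=\mathfrak L_1\times\mathfrak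 L_2$, and let $\Gamma\subseteq\mathfrak H^2\times\mathfrak L$ be a linear subspace such that $(\mathfrak L,\Gamma)$ is a *unitary boundary pair* for $V$: that is, $\ker\Gamma=\{\hat f:\{\hat f,0\}\in\Gamma\}=V$; all pairs of elements $\{\binom{f}{f'},\binom{u_1}{u_2}\}$, $\{\binom{g}{g'},\binom{v_1}{v_2}\}$ of $\Gamma$ satisfy $$[f,g]-[f',g']=(u_1,v_1)_{\mathfrak L_1}-(u_2,v_2)_{\mathfrak L_2};\qquad(*)$$ and every $\{\binom{g}{g'},\binom{v_1}{v_2}\}\in\mathfrak H^2\times\mathfrak L$ which satisfies $(*)$ for all $\{\binom{f}{f'},\binom{u_1}{u_2}\}\in\Gamma$ belongs to $\Gamma$. Put $$V_1=\{\hat f:\{\hat f,\tbinom{0}{u_2}\}\in\Gamma\text{ for some }u_2\},\qquad V_2=\{\hat f:\{\hat f,\tbinom{u_1}{0}\}\in\Gamma\text{ for some }u_1\},$$ $\mathcal D=\rho(V_1)\cap\mathbb D$ and $\mathcal D_e=\rho(V_2)\cap\mathbb D_e$. For $\lambda\in\mathcal D$ (resp. $\lambda\in\mathcal D_e$) let $\gamma_1(\lambda)$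 (resp. $\gamma_2(\lambda)$) be the linear relation of all $\{u_1,f\}$ (resp. $\{u_2,f\}$) with $\{\binom{f}{\lambda f},\binom{u_1}{u_2}\}\in\Gamma$ for some $u_2$ (resp. some $u_1$), and for $\lambda\in\mathcal D$ let $\Theta(\lambda)$ (the Weyl function) be the relation of all $\{u_1,u_2\}$ with $\{\binom{f}{\lambda f},\binom{u_1}{u_2}\}\in\Gamma$ for some $f$. A $\mathbf B(\mathfrak L_1,\mathfrak L_2)$-valued function $\Theta$ holomorphic on an open set $\Omega\subseteq\mathbb D$ belongs to the generalized Schur class $\mathcal S_{k}(\mathfrak L_1,\mathfrak L_2)$ if the kernel $K_\omega(\lambda)=(I-\Theta(\lambda)\Theta(\omega)^*)/(1-\lambda\bar\omega)$ has $k$ negative squares on $\Omega\times\Omega$: each Hermitian matrix $\big((K_{\omega_j}(\omega_i)f_j,f_i)\big)_{i,j=1}^n$ with $\omega_i\in\Omega$, $f_i\in\mathfrak L_2$ has at most $k$ negative eigenvalues (with multiplicity), and some such matrix has exactly $k$. The operator $V$ is *simple* if all its eigenvalues lie on $|\lambda|=1$ and the subspaces $\{f:\{f,\lambda f\}\in V^{-[*]}\}$,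 $|\lambda|\ne1$, have dense linear span in $\mathfrak H$. **Theorem.** 1. $V_1$ and $V_2$ are closed and $V_1=V_2^{-[*]}$. Moreover $\mathcal D=\mathbb D\setminus\sigma_p(V_1)$, $\mathcal D_e=\mathbb D_e\setminus\sigma_p(V_2)$ and $\mathcal D_e=\{\lambda\in\mathbb D_e:1/\bar\lambda\in\mathcal D\}$. The sets $\mathcal D$ and $\mathcal D_e$ are nonempty and open, and each of $\mathbb D\setminus\mathcal D$ and $\mathbb D_e\setminus\mathcal D_e$ has at most $\kappa$ points. 2. For $\lambda\in\mathcal D$ the relation $\gamma_1(\lambda)$ is an operator in $\mathbf B(\mathfrak L_1,\mathfrak H)$, and $\gamma_1$ is holomorphic on $\mathcal D$. 3. For $\lambda\in\mathcal D_e$ the relation $\gamma_2(\lambda)$ is an operator in $\mathbf B(\mathfrak L_2,\mathfrak H)$, and $\gamma_2$ is holomorphic on $\mathcal D_e$. If $0\in\mathcal D$ and $\gamma_2^\#(\lambda)=\gamma_2(1/\bar\lambda)^{[*]}\in\mathbf B(\mathfrak H,\mathfrak L_2)$ for $\lambda\in\mathcal D\setminus\{0\}$ (the adjoint being determined by $(\gamma_2(\mu)^{[*]}f,u_2)_{\mathfrak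 L_2}=[f,\gamma_2(\mu)u_2]$), then, in operator norm, $\lim_{\lambda\to0}\gamma_2^\#(\lambda)=0$, and $\lim_{\lambda\to0}\lambda^{-1}\gamma_2^\#(\lambda)$ exists in $\mathbf B(\mathfrak H,\mathfrak L_2)$. 4. For $\lambda\in\mathcal D$ the relation $\Theta(\lambda)$ is an operator in $\mathbf B(\mathfrak L_1,\mathfrak L_2)$, and $\Theta$ is holomorphic on $\mathcal D$. It belongs to $\mathcal S_{\kappa'}(\mathfrak L_1,\mathfrak L_2)$ for some $\kappa'\le\kappa$, and if $V$ is simple, it belongs to $\mathcal S_\kappa(\mathfrak L_1,\mathfrak L_2)$. 5. $\left\{\binom{\gamma_1(\lambda)u_1}{\lambda\gamma_1(\lambda)u_1},\binom{u_1}{\Theta(\lambda)u_1}\right\}\in\Gamma$ for all $\lambda\in\mathcal D$, $u_1\in\mathfrak L_1$, and $\left\{\binom{\gamma_2(\lambda)u_2}{\lambda\gamma_2(\lambda)u_2},\binom{\Theta(1/\bar\lambda)^*u_2}{u_2}\right\}\in\Gamma$ for all $\lambda\in\mathcal D_e$, $u_2\in\mathfrak L_2$. 6. $\gamma_1(\lambda)=\gamma_1(\mu)+(\lambda-\mu)(V_1-\lambda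 I)^{-1}\gamma_1(\mu)$ for all $\lambda,\mu\in\mathcal D$, and $\gamma_2(\lambda)=\gamma_2(\mu)+(\lambda-\mu)(V_2-\lambda I)^{-1}\gamma_2(\mu)$ for all $\lambda,\mu\in\mathcal D_e$. -/

import Mathlib

open Filter Topology ComplexConjugate

noncomputable section

namespace BoundaryPair

section Relations

variable {E F : Type*} [AddCommGroup E] [Module ℂ E] [AddCommGroup F] [Module ℂ F]

/-! A linear relation from `E` to `F` is a linear subspace of `E × F`. -/

/-- The inverse relation `T⁻¹ = {(g, f) : (f, g) ∈ T}`. -/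
def invRel (T : Submodule ℂ (E × F)) : Submodule ℂ (F × E) :=
  T.comap (LinearEquiv.prodComm ℂ F E).toLinearMap

/-- The kernel `{f : (f, 0) ∈ T}`. -/
def kerRel (T : Submodule ℂ (E × F)) : Submodule ℂ E :=
  T.comap (LinearMap.inl ℂ E F)

/-- The multivalued part `{g : (0, g) ∈ T}`. -/
def mulRel (T : Submodule ℂ (E × F)) : Submodule ℂ F :=
  T.comap (LinearMap.inr ℂ E F)

/-- The relation `T - z I = {(f, g - z f) : (f, g) ∈ T}`. -/
def shiftRel (T : Submodule ℂ (E × E)) (z : ℂ) : Submodule ℂ (E × E) :=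
  T.map ((LinearMap.fst ℂ E E).prod (LinearMap.snd ℂ E E - z • LinearMap.fst ℂ E E))

/-- The embedding `f ↦ (f, z f)` of `E` into `E × E`. -/
def eigenEmb (E : Type*) [AddCommGroup E] [Module ℂ E] (z : ℂ) : E →ₗ[ℂ] E × E :=
  (LinearMap.id : E →ₗ[ℂ] E).prod (z • LinearMap.id)

/-- The point spectrum of a linear relation: all `z` such that `(f, z f) ∈ T` for some `f ≠ 0`. -/
def pointSpectrum (T : Submodule ℂ (E × E)) : Set ℂ :=
  {z | ∃ f : E, f ≠ 0 ∧ (f, z • f) ∈ T}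

theorem mem_invRel (T : Submodule ℂ (E × F)) (f : E) (g : F) :
    (g, f) ∈ invRel T ↔ (f, g) ∈ T := Iff.rfl

theorem mem_kerRel (T : Submodule ℂ (E × F)) (f : E) : f ∈ kerRel T ↔ (f, 0) ∈ T := Iff.rfl

theorem mem_mulRel (T : Submodule ℂ (E × F)) (g : F) : g ∈ mulRel T ↔ (0, g) ∈ T := Iff.rfl

theorem mem_shiftRel (T : Submodule ℂ (E × E)) (z : ℂ) (f g : E) :
    (f, g) ∈ shiftRel T z ↔ (f, g + z • f) ∈ T := by
  constructor
  · rintro ⟨⟨a, b⟩, hab, h⟩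
    have h1 : a = f := congrArg Prod.fst h
    have h2 : b - z • a = g := congrArg Prod.snd h
    subst h1 h2
    simpa using hab
  · intro h
    exact ⟨(f, g + z • f), h, by simp⟩

end Relations

section Resolvent

variable {H : Type*} [NormedAddCommGroup H] [InnerProductSpace ℂ H]

/-- `R = (T - z I)⁻¹`, where `R` is a bounded operator defined on the whole space. -/
def IsResolventAt (T : Submodule ℂ (H × H)) (z : ℂ) (R : H →L[ℂ] H) : Prop :=
  (R : H →ₗ[ℂ] H).graph = invRel (shiftRel T z)

/-- The resolvent set `ρ(T)` of a linear relation: all `z` such that `(T - z I)⁻¹` is the graph of a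
bounded everywhere defined operator. -/
def resolventSetRel (T : Submodule ℂ (H × H)) : Set ℂ :=
  {z | ∃ R : H →L[ℂ] H, IsResolventAt T z R}

open Classical in
/-- The operator `(T - z I)⁻¹` for `z ∈ ρ(T)` (and `0` for `z ∉ ρ(T)`). -/
def resolventRel (T : Submodule ℂ (H × H)) (z : ℂ) : H →L[ℂ] H :=
  if h : ∃ R : H →L[ℂ] H, IsResolventAt T z R then h.choose else 0

theorem isResolventAt_resolventRel {T : Submodule ℂ (H × H)} {z : ℂ}
    (hz : z ∈ resolventSetRel T) : IsResolventAt T z (resolventRel T z) := by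
  have h : ∃ R : H →L[ℂ] H, IsResolventAt T z R := hz
  rw [resolventRel, dif_pos h]
  exact h.choose_spec

end Resolvent

section Pontryagin

variable {H : Type*} [NormedAddCommGroup H] [InnerProductSpace ℂ H] [CompleteSpace H]

/-- `J` is the fundamental symmetry of a Pontryagin space structure with negative index `κ` on the
Hilbert space `H`: `J = J* = J⁻¹` and the negative subspace `H₋ = ker (J + I)` has
dimension `κ < ∞`. -/
structure IsPontryaginSymmetry (J : H →L[ℂ] H) (κ : ℕ) : Prop where
  selfAdjoint : IsSelfAdjoint J
  sq_eq_one : J * J = 1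
  finite_neg : FiniteDimensional ℂ (LinearMap.ker ((J + 1 : H →L[ℂ] H) : H →ₗ[ℂ] H))
  finrank_neg : Module.finrank ℂ (LinearMap.ker ((J + 1 : H →L[ℂ] H) : H →ₗ[ℂ] H)) = κ

/-- The indefinite inner product `[f, g] = (J f, g)`, linear in `f` and antilinear in `g`
(Mathlib's `inner` is linear in its second argument). -/
def indef (J : H →L[ℂ] H) (f g : H) : ℂ := inner ℂ g (J f)

/-- The adjoint of a linear relation in the Pontryagin space `(H, J)`:
`T^[*] = {(h, k) : [k, f] = [h, g] for all (f, g) ∈ T}`. -/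
def adjRel (J : H →L[ℂ] H) (T : Submodule ℂ (H × H)) : Submodule ℂ (H × H) where
  carrier := {p | ∀ q ∈ T, indef J p.2 q.1 = indef J p.1 q.2}
  zero_mem' := by intro q _; simp [indef]
  add_mem' := by
    intro a b ha hb q hq
    have h1 := ha q hq
    have h2 := hb q hq
    simp only [indef, Prod.fst_add, Prod.snd_add, map_add, inner_add_right] at h1 h2 ⊢
    rw [h1, h2]
  smul_mem' := by
    intro c a ha q hq
    have h1 := ha q hq
    simp only [indef, Prod.smul_fst, Prod.smul_snd, map_smul, inner_smul_right] at h1 ⊢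
    rw [h1]

/-- `V` is (the graph of) a closed single-valued isometric operator in `(H, J)`. -/
structure IsClosedIsometricOperator (J : H →L[ℂ] H) (V : Submodule ℂ (H × H)) : Prop where
  closed : IsClosed (V : Set (H × H))
  singleValued : mulRel V = ⊥
  isometric : ∀ f g : H, (f, g) ∈ V → indef J g g = indef J f f

/-- The defect subspace `N_z = {f : (f, z f) ∈ V^{-[*]}}`. -/
def defectSubspace (J : H →L[ℂ] H) (V : Submodule ℂ (H × H)) (z : ℂ) : Submodule ℂ H :=
  (invRel (adjRel J V)).comap (eigenEmb H z)

/-- `V` is simple: it has no eigenvalues off the unit circle, and its defect subspaces `N_z`,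
`|z| ≠ 1`, span a dense subspace. -/
def IsSimpleIsometric (J : H →L[ℂ] H) (V : Submodule ℂ (H × H)) : Prop :=
  (∀ z ∈ pointSpectrum V, ‖z‖ = 1) ∧
    (⨆ z ∈ {z : ℂ | ‖z‖ ≠ 1}, defectSubspace J V z).topologicalClosure = ⊤

/-- The adjoint `A^[*]` of a bounded operator from a Hilbert space `L` to the Pontryagin space
`(H, J)`, that is, `(A^[*] f, u) = [f, A u]`. -/
def pontAdjoint {L : Type*} [NormedAddCommGroup L] [InnerProductSpace ℂ L] [CompleteSpace L]
    (J : H →L[ℂ] H) (A : L →L[ℂ] H) : H →L[ℂ] L :=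
  ContinuousLinearMap.adjoint A ∘L J

theorem inner_pontAdjoint {L : Type*} [NormedAddCommGroup L] [InnerProductSpace ℂ L]
    [CompleteSpace L] (J : H →L[ℂ] H) (A : L →L[ℂ] H) (f : H) (u : L) :
    inner ℂ u (pontAdjoint J A f) = indef J f (A u) := by
  simp [pontAdjoint, indef, ContinuousLinearMap.adjoint_inner_right]

end Pontryagin

section Pair

variable {H L₁ L₂ : Type*}
  [NormedAddCommGroup H] [InnerProductSpace ℂ H]
  [NormedAddCommGroup L₁] [InnerProductSpace ℂ L₁]
  [NormedAddCommGroup L₂] [InnerProductSpace ℂ L₂]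

/-- The identity `[f, g] - [f', g'] = (u₁, v₁) - (u₂, v₂)` for the pairs
`p = {(f, f'), (u₁, u₂)}` and `q = {(g, g'), (v₁, v₂)}`. -/
def GreenIdentity (J : H →L[ℂ] H) (p q : (H × H) × (L₁ × L₂)) : Prop :=
  indef J p.1.1 q.1.1 - indef J p.1.2 q.1.2 = inner ℂ q.2.1 p.2.1 - inner ℂ q.2.2 p.2.2

/-- `(L₁ × L₂, Γ)` is a unitary boundary pair for `V`. -/
structure IsUnitaryBoundaryPair (J : H →L[ℂ] H) (V : Submodule ℂ (H × H))
    (Γ : Submodule ℂ ((H × H) × (L₁ × L₂))) : Prop where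
  ker_eq : kerRel Γ = V
  green : ∀ p ∈ Γ, ∀ q ∈ Γ, GreenIdentity J p q
  maximal : ∀ q : (H × H) × (L₁ × L₂), (∀ p ∈ Γ, GreenIdentity J p q) → q ∈ Γ

/-- `Γ₁ = {(f̂, u₁) : (f̂, (u₁, u₂)) ∈ Γ for some u₂}`. -/
def comp₁ (Γ : Submodule ℂ ((H × H) × (L₁ × L₂))) : Submodule ℂ ((H × H) × L₁) :=
  Γ.map (LinearMap.prodMap LinearMap.id (LinearMap.fst ℂ L₁ L₂))

/-- `Γ₂ = {(f̂, u₂) : (f̂, (u₁, u₂)) ∈ Γ for some u₁}`. -/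
def comp₂ (Γ : Submodule ℂ ((H × H) × (L₁ × L₂))) : Submodule ℂ ((H × H) × L₂) :=
  Γ.map (LinearMap.prodMap LinearMap.id (LinearMap.snd ℂ L₁ L₂))

/-- `V₁ = ker Γ₁`. -/
def ext₁ (Γ : Submodule ℂ ((H × H) × (L₁ × L₂))) : Submodule ℂ (H × H) := kerRel (comp₁ Γ)

/-- `V₂ = ker Γ₂`. -/
def ext₂ (Γ : Submodule ℂ ((H × H) × (L₁ × L₂))) : Submodule ℂ (H × H) := kerRel (comp₂ Γ)

/-- The set `D = ρ(V₁) ∩ 𝔻`. -/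
def innerDomain (Γ : Submodule ℂ ((H × H) × (L₁ × L₂))) : Set ℂ :=
  resolventSetRel (ext₁ Γ) ∩ {z | ‖z‖ < 1}

/-- The set `D_e = ρ(V₂) ∩ 𝔻_e`. -/
def outerDomain (Γ : Submodule ℂ ((H × H) × (L₁ × L₂))) : Set ℂ :=
  resolventSetRel (ext₂ Γ) ∩ {z | 1 < ‖z‖}

/-- The linear relation `γ₁(z) = {(u₁, f) : ((f, z f), u₁) ∈ Γ₁}` from `L₁` to `H`. -/
def gammaRel₁ (Γ : Submodule ℂ ((H × H) × (L₁ × L₂))) (z : ℂ) : Submodule ℂ (L₁ × H) :=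
  invRel ((comp₁ Γ).comap (LinearMap.prodMap (eigenEmb H z) LinearMap.id))

/-- The linear relation `γ₂(z) = {(u₂, f) : ((f, z f), u₂) ∈ Γ₂}` from `L₂` to `H`. -/
def gammaRel₂ (Γ : Submodule ℂ ((H × H) × (L₁ × L₂))) (z : ℂ) : Submodule ℂ (L₂ × H) :=
  invRel ((comp₂ Γ).comap (LinearMap.prodMap (eigenEmb H z) LinearMap.id))

/-- The Weyl family `Θ(z) = {(u₁, u₂) : ((f, z f), (u₁, u₂)) ∈ Γ for some f}`. -/
def weylRel (Γ : Submodule ℂ ((H × H) × (L₁ × L₂))) (z : ℂ) : Submodule ℂ (L₁ × L₂) :=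
  (Γ.comap (LinearMap.prodMap (eigenEmb H z) LinearMap.id)).map
    (LinearMap.snd ℂ H (L₁ × L₂))

theorem mem_ext₁ (Γ : Submodule ℂ ((H × H) × (L₁ × L₂))) (f f' : H) :
    (f, f') ∈ ext₁ Γ ↔ ∃ u₂ : L₂, ((f, f'), ((0 : L₁), u₂)) ∈ Γ := by
  constructor
  · rintro ⟨⟨⟨a, b⟩, u, v⟩, h, he⟩
    simp only [LinearMap.prodMap_apply, LinearMap.id_apply, LinearMap.fst_apply,
      LinearMap.inl_apply, Prod.mk.injEq] at he
    obtain ⟨⟨rfl, rfl⟩, rfl⟩ := he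
    exact ⟨v, h⟩
  · rintro ⟨v, h⟩
    exact ⟨_, h, rfl⟩

theorem mem_ext₂ (Γ : Submodule ℂ ((H × H) × (L₁ × L₂))) (f f' : H) :
    (f, f') ∈ ext₂ Γ ↔ ∃ u₁ : L₁, ((f, f'), (u₁, (0 : L₂))) ∈ Γ := by
  constructor
  · rintro ⟨⟨⟨a, b⟩, u, v⟩, h, he⟩
    simp only [LinearMap.prodMap_apply, LinearMap.id_apply, LinearMap.snd_apply,
      LinearMap.inl_apply, Prod.mk.injEq] at he
    obtain ⟨⟨rfl, rfl⟩, rfl⟩ := he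
    exact ⟨u, h⟩
  · rintro ⟨v, h⟩
    exact ⟨_, h, rfl⟩

theorem mem_gammaRel₁ (Γ : Submodule ℂ ((H × H) × (L₁ × L₂))) (z : ℂ) (u₁ : L₁) (f : H) :
    (u₁, f) ∈ gammaRel₁ Γ z ↔ ∃ u₂ : L₂, ((f, z • f), (u₁, u₂)) ∈ Γ := by
  constructor
  · rintro ⟨⟨⟨a, b⟩, u, v⟩, h, he⟩
    simp only [LinearMap.prodMap_apply, LinearMap.id_apply, LinearMap.fst_apply, eigenEmb,
      LinearEquiv.coe_coe, LinearEquiv.prodComm_apply, Prod.swap_prod_mk, LinearMap.prod_apply,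
      Prod.mk.injEq] at he
    obtain ⟨⟨rfl, rfl⟩, rfl⟩ := he
    exact ⟨v, h⟩
  · rintro ⟨v, h⟩
    exact ⟨_, h, rfl⟩

theorem mem_gammaRel₂ (Γ : Submodule ℂ ((H × H) × (L₁ × L₂))) (z : ℂ) (u₂ : L₂) (f : H) :
    (u₂, f) ∈ gammaRel₂ Γ z ↔ ∃ u₁ : L₁, ((f, z • f), (u₁, u₂)) ∈ Γ := by
  constructor
  · rintro ⟨⟨⟨a, b⟩, u, v⟩, h, he⟩
    simp only [LinearMap.prodMap_apply, LinearMap.id_apply, LinearMap.snd_apply, eigenEmb,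
      LinearEquiv.coe_coe, LinearEquiv.prodComm_apply, Prod.swap_prod_mk, LinearMap.prod_apply,
      Prod.mk.injEq] at he
    obtain ⟨⟨rfl, rfl⟩, rfl⟩ := he
    exact ⟨u, h⟩
  · rintro ⟨v, h⟩
    exact ⟨_, h, rfl⟩

theorem mem_weylRel (Γ : Submodule ℂ ((H × H) × (L₁ × L₂))) (z : ℂ) (u₁ : L₁) (u₂ : L₂) :
    (u₁, u₂) ∈ weylRel Γ z ↔ ∃ f : H, ((f, z • f), (u₁, u₂)) ∈ Γ := by
  constructor
  · rintro ⟨⟨a, u, v⟩, h, he⟩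
    simp only [LinearMap.snd_apply, Prod.mk.injEq] at he
    obtain ⟨rfl, rfl⟩ := he
    exact ⟨a, h⟩
  · rintro ⟨f, h⟩
    exact ⟨(f, (u₁, u₂)), h, rfl⟩

end Pair

section Schur

variable {L₁ L₂ : Type*}
  [NormedAddCommGroup L₁] [InnerProductSpace ℂ L₁] [CompleteSpace L₁]
  [NormedAddCommGroup L₂] [InnerProductSpace ℂ L₂] [CompleteSpace L₂]

/-- The kernel `K_w(z) = (I - Θ(z) Θ(w)*) / (1 - z w̄)`. -/
def schurKernel (Θ : ℂ → L₁ →L[ℂ] L₂) (w z : ℂ) : L₂ →L[ℂ] L₂ :=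
  (1 - z * conj w)⁻¹ • (1 - Θ z ∘L ContinuousLinearMap.adjoint (Θ w))

/-- The matrix with entries `(K_{ω_j}(ω_i) f_j, f_i)`. -/
def schurGram (Θ : ℂ → L₁ →L[ℂ] L₂) {n : ℕ} (ω : Fin n → ℂ) (f : Fin n → L₂) :
    Matrix (Fin n) (Fin n) ℂ :=
  Matrix.of fun i j => inner ℂ (f i) (schurKernel Θ (ω j) (ω i) (f j))

theorem schurGram_isHermitian (Θ : ℂ → L₁ →L[ℂ] L₂) {n : ℕ} (ω : Fin n → ℂ) (f : Fin n → L₂) :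
    (schurGram Θ ω f).IsHermitian := by
  ext i j
  simp only [schurGram, schurKernel, Matrix.conjTranspose_apply, Matrix.of_apply,
    smul_apply, sub_apply, one_apply_eq_self,
    ContinuousLinearMap.comp_apply, inner_smul_right, inner_sub_right, RCLike.star_def, map_mul,
    map_sub, map_inv₀, map_one, Complex.conj_conj, inner_conj_symm]
  rw [← ContinuousLinearMap.adjoint_inner_right (Θ (ω j)),
    ← ContinuousLinearMap.adjoint_inner_left (Θ (ω i)), mul_comm (conj (ω j))]

/-- The number of negative eigenvalues, with multiplicities, of a Hermitian matrix. -/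
def negEigCount {n : ℕ} {A : Matrix (Fin n) (Fin n) ℂ} (hA : A.IsHermitian) : ℕ :=
  Nat.card {i : Fin n // hA.eigenvalues i < 0}

/-- The kernel `K_w(z)` has exactly `κ` negative squares on `Ω × Ω`. -/
def HasNegSquares (κ : ℕ) (Θ : ℂ → L₁ →L[ℂ] L₂) (Ω : Set ℂ) : Prop :=
  (∀ (n : ℕ) (ω : Fin n → ℂ) (f : Fin n → L₂), (∀ i, ω i ∈ Ω) →
      negEigCount (schurGram_isHermitian Θ ω f) ≤ κ) ∧
    ∃ (n : ℕ) (ω : Fin n → ℂ) (f : Fin n → L₂), (∀ i, ω i ∈ Ω) ∧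
      negEigCount (schurGram_isHermitian Θ ω f) = κ

/-- `Θ`, considered on the open set `Ω ⊆ 𝔻`, belongs to the generalized Schur class `S_κ(L₁, L₂)`. -/
structure IsGenSchur (κ : ℕ) (Θ : ℂ → L₁ →L[ℂ] L₂) (Ω : Set ℂ) : Prop where
  isOpen : IsOpen Ω
  subset_disk : Ω ⊆ {z | ‖z‖ < 1}
  holomorphic : DifferentiableOn ℂ Θ Ω
  negSquares : HasNegSquares κ Θ Ω

end Schur

end BoundaryPair

end

open BoundaryPair

/-! With `P₊`, `P₋` the projections `posProj J`, `negProj J`, put `a = P₊ f' + P₋ f` and `b = P₊ f +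
P₋ f'`. Then `[f,f] - [f',f'] = ‖b‖² - ‖a‖²`, so the Green identity says that `(a, u₁) ↦ (b, u₂)` is
isometric between Hilbert spaces, and maximality makes it unitary (`exists_isScatteringBlock`). Let
`A, B, C, D` be its blocks. On pairs `(f, z f)` membership in `Γ` becomes an equation for the pencil
`(P₊ + z P₋) - A (z P₊ + P₋)`: `V₁`, `γ₁`, `Θ` are read off from its inverse, and `V₂`, `γ₂` from
the same pencil for `A*`.

In the disk the pencil is a finite rank perturbation of the invertible operator `1 - z A`, so it is
invertible exactly when it is injective, that is, when `z` is no eigenvalue of `V₁`. There are at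
most `κ` such eigenvalues (`card_le_of_mem_pointSpectrum`): along the iterates of a combination of
eigenvectors the form increases to `0`, so a combination with vanishing negative part must be
trivial.

The Green identity writes the Schur kernel as the Gram kernel of a field `g(z)` with values in the
Pontryagin space (`inner_schurKernel_transferFun`), hence at most `κ` negative squares. If `V` is
simple, it has no eigenvectors at all. Let `X` be the span of the ranges of `g(z)` and `N` the
intersection of the ranges of `V - z`, `|z| < 1`; they are orthogonal in the form. A Carathéodory
function and the maximum principle show that the form is nonnegative on `N`
(`re_indef_nonneg_of_mem_regularSubspace`), and an eigenvector argument makes it definite there.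
Hence `X + N` is dense and contains a `κ`-dimensional negative subspace; dropping the `N`-components
only lowers the form, so `X` has one as well. -/

noncomputable section

namespace BoundaryPair

/-! ### Maximal isometric relations between Hilbert spaces -/

section Scattering

/-- A maximal isometric relation between Hilbert spaces is the graph of a bounded operator. -/
theorem exists_clm_of_maximal_isometric {K₁ K₂ : Type*}
    [NormedAddCommGroup K₁] [InnerProductSpace ℂ K₁] [CompleteSpace K₁]
    [NormedAddCommGroup K₂] [InnerProductSpace ℂ K₂] [CompleteSpace K₂]
    (R : Submodule ℂ (K₁ × K₂))
    (iso : ∀ p ∈ R, ∀ q ∈ R, inner ℂ q.1 p.1 = inner ℂ q.2 p.2)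
    (maximal : ∀ q : K₁ × K₂, (∀ p ∈ R, inner ℂ q.1 p.1 = inner ℂ q.2 p.2) → q ∈ R) :
    ∃ W : K₁ →L[ℂ] K₂, ∀ p, p ∈ R ↔ p.2 = W p.1 := by
  -- By isometry and maximality together, `R` is cut out by the continuous equations given by its
  -- own elements.
  have hclosed : IsClosed (R : Set (K₁ × K₂)) := by
    have : (R : Set (K₁ × K₂)) = ⋂ p ∈ R, {q | inner ℂ q.1 p.1 = inner ℂ q.2 p.2} := by
      ext q
      simp only [SetLike.mem_coe, Set.mem_iInter, Set.mem_ofPred_eq]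
      exact ⟨fun hq p hp => iso p hp q hq, maximal q⟩
    rw [this]
    refine isClosed_biInter fun p _ => isClosed_eq ?_ ?_ <;> fun_prop
  have : CompleteSpace R := hclosed.completeSpace_coe
  have hnorm : ∀ p ∈ R, ‖p.1‖ = ‖p.2‖ := by
    intro p hp
    have h := iso p hp p hp
    rw [inner_self_eq_norm_sq_to_K, inner_self_eq_norm_sq_to_K] at h
    have h' : ‖p.1‖ ^ 2 = ‖p.2‖ ^ 2 := by exact_mod_cast h
    exact (sq_eq_sq₀ (norm_nonneg _) (norm_nonneg _)).1 h'
  -- The product carries the sup norm, and both components of an element of `R` have the same norm,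
  -- so the first projection is isometric.
  let i : R →ₗᵢ[ℂ] K₁ :=
    { toLinearMap := LinearMap.fst ℂ K₁ K₂ ∘ₗ R.subtype
      norm_map' := by
        intro p
        have h := hnorm p p.2
        change ‖(p : K₁ × K₂).1‖ = ‖(p : K₁ × K₂)‖
        rw [Prod.norm_def, ← h, max_self] }
  have hrange : IsClosed ((LinearMap.range i.toLinearMap : Submodule ℂ K₁) : Set K₁) :=
    i.isometry.isClosedEmbedding.isClosed_range
  have : CompleteSpace (LinearMap.range i.toLinearMap) := hrange.completeSpace_coe
  -- If `a` is orthogonal to the domain, maximality puts `(a, 0)` into `R`, and isometry gives `a =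
  -- 0`.
  have htop : LinearMap.range i.toLinearMap = ⊤ := by
    rw [← Submodule.orthogonal_eq_bot_iff, Submodule.eq_bot_iff]
    intro a ha
    have hmem : (a, (0 : K₂)) ∈ R := by
      refine maximal _ fun p hp => ?_
      simp only [inner_zero_left]
      exact Submodule.inner_left_of_mem_orthogonal (K := LinearMap.range i.toLinearMap)
        ⟨⟨p, hp⟩, rfl⟩ ha
    simpa using hnorm _ hmem
  let e := LinearIsometryEquiv.ofSurjective i (LinearMap.range_eq_top.1 htop)
  refine ⟨ContinuousLinearMap.snd ℂ K₁ K₂ ∘L R.subtypeL ∘L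
    (e.symm.toContinuousLinearEquiv : K₁ →L[ℂ] R), fun p => ?_⟩
  have key : ∀ p : R, (p : K₁ × K₂).2 = ((e.symm (p : K₁ × K₂).1 : R) : K₁ × K₂).2 := by
    intro p
    have : e p = (p : K₁ × K₂).1 := rfl
    rw [← this, e.symm_apply_apply]
  constructor
  · intro hp
    exact key ⟨p, hp⟩
  · intro hp
    have h1 : e (e.symm p.1) = p.1 := e.apply_symm_apply _
    have h2 : ((e.symm p.1 : R) : K₁ × K₂).1 = p.1 := h1
    have h3 : p = ((e.symm p.1 : R) : K₁ × K₂) := Prod.ext h2.symm hp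
    rw [h3]
    exact (e.symm p.1).2

end Scattering

/-! ### Fundamental projections of the Pontryagin space -/

section Projections

variable {H : Type*} [NormedAddCommGroup H] [InnerProductSpace ℂ H]

/-- The projection `(I + J) / 2`. -/
def posProj (J : H →L[ℂ] H) : H →L[ℂ] H := (1 / 2 : ℂ) • (1 + J)

/-- The projection `(I - J) / 2`. -/
def negProj (J : H →L[ℂ] H) : H →L[ℂ] H := (1 / 2 : ℂ) • (1 - J)

theorem posProj_add_negProj (J : H →L[ℂ] H) (f : H) : posProj J f + negProj J f = f := by
  simp only [posProj, negProj, smul_apply, add_apply, sub_apply, one_apply_eq_self]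
  module

theorem posProj_sub_negProj (J : H →L[ℂ] H) (f : H) : posProj J f - negProj J f = J f := by
  simp only [posProj, negProj, smul_apply, add_apply, sub_apply, one_apply_eq_self]
  module

theorem posProj_eq (J : H →L[ℂ] H) (f : H) : posProj J f = f - negProj J f :=
  eq_sub_of_add_eq (posProj_add_negProj J f)

variable [CompleteSpace H] {J : H →L[ℂ] H} {κ : ℕ}

namespace IsPontryaginSymmetry

variable (hJ : IsPontryaginSymmetry J κ)
include hJ

theorem apply_apply (f : H) : J (J f) = f := congrArg (fun T : H →L[ℂ] H => T f) hJ.sq_eq_one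

theorem posProj_posProj (f : H) : posProj J (posProj J f) = posProj J f := by
  simp only [posProj, smul_apply, add_apply, one_apply_eq_self, map_smul, map_add, hJ.apply_apply]
  module

theorem negProj_negProj (f : H) : negProj J (negProj J f) = negProj J f := by
  simp only [negProj, smul_apply, sub_apply, one_apply_eq_self, map_smul, map_sub, hJ.apply_apply]
  module

theorem posProj_negProj (f : H) : posProj J (negProj J f) = 0 := by
  simp only [posProj, negProj, smul_apply, sub_apply, add_apply, one_apply_eq_self, map_smul,
    map_sub, hJ.apply_apply]
  module

theorem negProj_posProj (f : H) : negProj J (posProj J f) = 0 := by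
  simp only [posProj, negProj, smul_apply, sub_apply, add_apply, one_apply_eq_self, map_smul,
    map_add, hJ.apply_apply]
  module

theorem inner_J_left (f g : H) : inner ℂ (J f) g = inner ℂ f (J g) := by
  have := ContinuousLinearMap.adjoint_inner_left J g f
  rwa [hJ.selfAdjoint.adjoint_eq] at this

theorem adjoint_posProj : ContinuousLinearMap.adjoint (posProj J) = posProj J := by
  have h : ContinuousLinearMap.adjoint J = J := hJ.selfAdjoint.adjoint_eq
  have h1 : ContinuousLinearMap.adjoint (1 : H →L[ℂ] H) = 1 := ContinuousLinearMap.adjoint_id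
  rw [posProj, map_smulₛₗ, map_add, h, h1]
  simp [Complex.conj_ofNat]

theorem adjoint_negProj : ContinuousLinearMap.adjoint (negProj J) = negProj J := by
  have h : ContinuousLinearMap.adjoint J = J := hJ.selfAdjoint.adjoint_eq
  have h1 : ContinuousLinearMap.adjoint (1 : H →L[ℂ] H) = 1 := ContinuousLinearMap.adjoint_id
  rw [negProj, map_smulₛₗ, map_sub, h, h1]
  simp [Complex.conj_ofNat]

theorem inner_posProj_left (f g : H) : inner ℂ (posProj J f) g = inner ℂ f (posProj J g) := by
  have := ContinuousLinearMap.adjoint_inner_left (posProj J) g f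
  rwa [hJ.adjoint_posProj] at this

theorem inner_negProj_left (f g : H) : inner ℂ (negProj J f) g = inner ℂ f (negProj J g) := by
  have := ContinuousLinearMap.adjoint_inner_left (negProj J) g f
  rwa [hJ.adjoint_negProj] at this

theorem inner_posProj_negProj (f g : H) : inner ℂ (posProj J f) (negProj J g) = 0 := by
  rw [hJ.inner_posProj_left, hJ.posProj_negProj, inner_zero_right]

theorem inner_negProj_posProj (f g : H) : inner ℂ (negProj J f) (posProj J g) = 0 := by
  rw [hJ.inner_negProj_left, hJ.negProj_posProj, inner_zero_right]

theorem inner_eq_add (f g : H) :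
    inner ℂ g f = inner ℂ (posProj J g) (posProj J f) + inner ℂ (negProj J g) (negProj J f) := by
  conv_lhs => rw [← posProj_add_negProj J f, ← posProj_add_negProj J g]
  rw [inner_add_left, inner_add_right, inner_add_right, hJ.inner_posProj_negProj,
    hJ.inner_negProj_posProj]
  ring

theorem indef_eq_sub (f g : H) :
    indef J f g =
      inner ℂ (posProj J g) (posProj J f) - inner ℂ (negProj J g) (negProj J f) := by
  conv_lhs => rw [indef, ← posProj_sub_negProj J f, ← posProj_add_negProj J g]
  rw [inner_add_left, inner_sub_right, inner_sub_right, hJ.inner_posProj_negProj,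
    hJ.inner_negProj_posProj]
  ring

theorem norm_sq_eq_add (f : H) : ‖f‖ ^ 2 = ‖posProj J f‖ ^ 2 + ‖negProj J f‖ ^ 2 := by
  have h := hJ.inner_eq_add f f
  simp only [inner_self_eq_norm_sq_to_K] at h
  exact_mod_cast h

theorem re_indef_self (f : H) :
    (indef J f f).re = ‖posProj J f‖ ^ 2 - ‖negProj J f‖ ^ 2 := by
  have h := hJ.indef_eq_sub f f
  simp only [inner_self_eq_norm_sq_to_K] at h
  rw [h]
  norm_cast

theorem indef_conj (f g : H) : conj (indef J f g) = indef J g f := by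
  rw [indef, inner_conj_symm, hJ.inner_J_left]; rfl

omit hJ [CompleteSpace H] in
theorem _root_.BoundaryPair.negProj_eq_self_iff (f : H) :
    negProj J f = f ↔ f ∈ LinearMap.ker ((J + 1 : H →L[ℂ] H) : H →ₗ[ℂ] H) := by
  rw [LinearMap.mem_ker]
  change _ ↔ J f + f = 0
  have h1 := posProj_add_negProj J f
  constructor
  · intro h
    have : posProj J f = 0 := by rw [posProj_eq, h, sub_self]
    simp only [posProj, smul_apply, add_apply, one_apply_eq_self] at this
    rw [smul_eq_zero] at this
    rw [add_comm]
    exact this.resolve_left (by norm_num)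
  · intro h
    have : posProj J f = 0 := by
      simp only [posProj, smul_apply, add_apply, one_apply_eq_self]
      rw [add_comm, h, smul_zero]
    rwa [this, zero_add] at h1

theorem negProj_mem (f : H) :
    negProj J f ∈ LinearMap.ker ((J + 1 : H →L[ℂ] H) : H →ₗ[ℂ] H) :=
  (negProj_eq_self_iff _).1 (hJ.negProj_negProj f)

theorem finiteDimensional_range_negProj :
    FiniteDimensional ℂ (LinearMap.range (negProj J : H →ₗ[ℂ] H)) := by
  have := hJ.finite_neg
  refine Submodule.finiteDimensional_of_le
    (S₂ := LinearMap.ker ((J + 1 : H →L[ℂ] H) : H →ₗ[ℂ] H)) ?_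
  rintro _ ⟨f, rfl⟩
  exact hJ.negProj_mem f

/-- The form is a difference of two Hilbert space inner products in the coordinates
`P₊ f' + P₋ f` and `P₊ f + P₋ f'`. -/
theorem indef_sub_indef (f f' g g' : H) :
    indef J f g - indef J f' g' =
      inner ℂ (posProj J g + negProj J g') (posProj J f + negProj J f') -
        inner ℂ (posProj J g' + negProj J g) (posProj J f' + negProj J f) := by
  simp only [hJ.indef_eq_sub, inner_add_left, inner_add_right, hJ.inner_posProj_negProj,
    hJ.inner_negProj_posProj]
  ring

theorem posProj_add (a b : H) : posProj J (posProj J a + negProj J b) = posProj J a := by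
  rw [map_add, hJ.posProj_posProj, hJ.posProj_negProj, add_zero]

theorem negProj_add (a b : H) : negProj J (posProj J a + negProj J b) = negProj J b := by
  rw [map_add, hJ.negProj_posProj, hJ.negProj_negProj, zero_add]

end IsPontryaginSymmetry

end Projections

/-! ### The unitary operator behind a unitary boundary pair -/

section ScatteringOperator

variable {H L₁ L₂ : Type*}
  [NormedAddCommGroup H] [InnerProductSpace ℂ H] [CompleteSpace H]
  [NormedAddCommGroup L₁] [InnerProductSpace ℂ L₁] [CompleteSpace L₁]
  [NormedAddCommGroup L₂] [InnerProductSpace ℂ L₂] [CompleteSpace L₂]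

/-- The blocks of a unitary operator `H × L₁ → H × L₂` whose graph, in the coordinates
`P₊ f' + P₋ f` and `P₊ f + P₋ f'`, is `Γ`. -/
structure IsScatteringBlock (J : H →L[ℂ] H) (Γ : Submodule ℂ ((H × H) × (L₁ × L₂)))
    (A : H →L[ℂ] H) (B : L₁ →L[ℂ] H) (C : H →L[ℂ] L₂) (D : L₁ →L[ℂ] L₂) : Prop where
  mem_iff : ∀ f f' u₁ u₂, ((f, f'), (u₁, u₂)) ∈ Γ ↔
    posProj J f + negProj J f' = A (posProj J f' + negProj J f) + B u₁ ∧
      u₂ = C (posProj J f' + negProj J f) + D u₁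
  mem_iff_adjoint : ∀ f f' u₁ u₂, ((f, f'), (u₁, u₂)) ∈ Γ ↔
    posProj J f' + negProj J f =
        ContinuousLinearMap.adjoint A (posProj J f + negProj J f') +
          ContinuousLinearMap.adjoint C u₂ ∧
      u₁ = ContinuousLinearMap.adjoint B (posProj J f + negProj J f') +
        ContinuousLinearMap.adjoint D u₂

/-- In the coordinates of `indef_sub_indef` the Green identity is equality of two inner products,
and maximality of `Γ` is maximality of an isometric relation. `WithLp 2` supplies the Hilbert norm
on the products. -/
theorem IsUnitaryBoundaryPair.exists_isScatteringBlock {J : H →L[ℂ] H} {κ : ℕ}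
    (hJ : IsPontryaginSymmetry J κ) {V : Submodule ℂ (H × H)}
    {Γ : Submodule ℂ ((H × H) × (L₁ × L₂))} (hΓ : IsUnitaryBoundaryPair J V Γ) :
    ∃ (A : H →L[ℂ] H) (B : L₁ →L[ℂ] H) (C : H →L[ℂ] L₂) (D : L₁ →L[ℂ] L₂),
      IsScatteringBlock J Γ A B C D := by
  let toIn : WithLp 2 (H × L₁) →ₗ[ℂ] H × L₁ := (WithLp.linearEquiv 2 ℂ (H × L₁)).toLinearMap
  let toOut : WithLp 2 (H × L₂) →ₗ[ℂ] H × L₂ := (WithLp.linearEquiv 2 ℂ (H × L₂)).toLinearMap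
  -- recover `((f, f'), (u₁, u₂))` from the two coordinate vectors
  let φ : WithLp 2 (H × L₁) × WithLp 2 (H × L₂) →ₗ[ℂ] (H × H) × (L₁ × L₂) :=
    let a := LinearMap.fst ℂ H L₁ ∘ₗ toIn ∘ₗ LinearMap.fst ℂ _ (WithLp 2 (H × L₂))
    let b := LinearMap.fst ℂ H L₂ ∘ₗ toOut ∘ₗ LinearMap.snd ℂ (WithLp 2 (H × L₁)) _
    let u := LinearMap.snd ℂ H L₁ ∘ₗ toIn ∘ₗ LinearMap.fst ℂ _ (WithLp 2 (H × L₂))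
    let v := LinearMap.snd ℂ H L₂ ∘ₗ toOut ∘ₗ LinearMap.snd ℂ (WithLp 2 (H × L₁)) _
    (((posProj J : H →ₗ[ℂ] H) ∘ₗ b + (negProj J : H →ₗ[ℂ] H) ∘ₗ a).prod
      ((posProj J : H →ₗ[ℂ] H) ∘ₗ a + (negProj J : H →ₗ[ℂ] H) ∘ₗ b)).prod (u.prod v)
  have hφ : ∀ p, φ p = ((posProj J p.2.fst + negProj J p.1.fst,
      posProj J p.1.fst + negProj J p.2.fst), (p.1.snd, p.2.snd)) := fun p => rfl
  have hgreen : ∀ p q, GreenIdentity J (φ p) (φ q) ↔ inner ℂ q.1 p.1 = inner ℂ q.2 p.2 := by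
    intro p q
    simp only [GreenIdentity, hφ, hJ.indef_sub_indef, hJ.posProj_add, hJ.negProj_add,
      posProj_add_negProj, WithLp.prod_inner_apply, WithLp.ofLp_fst, WithLp.ofLp_snd]
    constructor <;> intro h <;> linear_combination -h
  have hsurj : ∀ f f' : H, ∀ u₁ : L₁, ∀ u₂ : L₂,
      φ (WithLp.toLp 2 (posProj J f' + negProj J f, u₁),
        WithLp.toLp 2 (posProj J f + negProj J f', u₂)) = ((f, f'), (u₁, u₂)) := by
    intro f f' u₁ u₂
    simp [hφ, hJ.posProj_posProj, hJ.negProj_negProj, hJ.posProj_negProj, hJ.negProj_posProj,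
      posProj_add_negProj]
  have hiso : ∀ p ∈ Γ.comap φ, ∀ q ∈ Γ.comap φ, inner ℂ q.1 p.1 = inner ℂ q.2 p.2 :=
    fun p hp q hq => (hgreen p q).1 (hΓ.green _ hp _ hq)
  have hmax : ∀ q, (∀ p ∈ Γ.comap φ, inner ℂ q.1 p.1 = inner ℂ q.2 p.2) → q ∈ Γ.comap φ := by
    intro q hq
    refine hΓ.maximal _ ?_
    rintro ⟨⟨f, f'⟩, u₁, u₂⟩ hp
    rw [← hsurj f f' u₁ u₂] at hp ⊢
    exact (hgreen _ q).2 (hq _ hp)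
  -- The hypotheses are symmetric in the two sides, so the inverse relation is a graph too and `W`
  -- is unitary.
  obtain ⟨W, hW⟩ := exists_clm_of_maximal_isometric (Γ.comap φ) hiso hmax
  obtain ⟨W', hW'⟩ := exists_clm_of_maximal_isometric
    ((Γ.comap φ).comap (LinearEquiv.prodComm ℂ _ _).toLinearMap)
    (fun p hp q hq => (hiso p.swap hp q.swap hq).symm)
    (fun q hq => hmax q.swap fun p hp => (hq p.swap hp).symm)
  have hW'' : ∀ p, p ∈ Γ.comap φ ↔ p.1 = W' p.2 := fun p => hW' p.swap
  have hadj : W' = ContinuousLinearMap.adjoint W := by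
    refine (ContinuousLinearMap.eq_adjoint_iff _ _).2 fun y x => ?_
    exact (hiso (x, W x) ((hW _).2 rfl) (W' y, y) ((hW'' _).2 rfl))
  let E₁ := WithLp.prodContinuousLinearEquiv 2 ℂ H L₁
  let E₂ := WithLp.prodContinuousLinearEquiv 2 ℂ H L₂
  let W₀ : H × L₁ →L[ℂ] H × L₂ := (E₂ : _ →L[ℂ] _) ∘L W ∘L (E₁.symm : _ →L[ℂ] _)
  let A := ContinuousLinearMap.fst ℂ H L₂ ∘L W₀ ∘L ContinuousLinearMap.inl ℂ H L₁
  let B := ContinuousLinearMap.fst ℂ H L₂ ∘L W₀ ∘L ContinuousLinearMap.inr ℂ H L₁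
  let C := ContinuousLinearMap.snd ℂ H L₂ ∘L W₀ ∘L ContinuousLinearMap.inl ℂ H L₁
  let D := ContinuousLinearMap.snd ℂ H L₂ ∘L W₀ ∘L ContinuousLinearMap.inr ℂ H L₁
  have hWblock : ∀ a u, W (WithLp.toLp 2 (a, u)) = WithLp.toLp 2 (A a + B u, C a + D u) := by
    intro a u
    have h1 : WithLp.toLp 2 (a, u) = WithLp.toLp 2 (a, (0 : L₁)) + WithLp.toLp 2 ((0 : H), u) := by
      rw [← WithLp.toLp_add]; simp
    rw [h1, map_add]
    rfl
  have hWadj : ∀ b v, W' (WithLp.toLp 2 (b, v)) =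
      WithLp.toLp 2 (ContinuousLinearMap.adjoint A b + ContinuousLinearMap.adjoint C v,
        ContinuousLinearMap.adjoint B b + ContinuousLinearMap.adjoint D v) := by
    intro b v
    refine ext_inner_right ℂ fun x => ?_
    obtain ⟨⟨a, u⟩⟩ := x
    rw [hadj, ContinuousLinearMap.adjoint_inner_left, hWblock]
    simp only [WithLp.prod_inner_apply, inner_add_left, inner_add_right,
      ContinuousLinearMap.adjoint_inner_left]
    ring
  refine ⟨A, B, C, D, ⟨fun f f' u₁ u₂ => ?_, fun f f' u₁ u₂ => ?_⟩⟩
  · rw [← hsurj f f' u₁ u₂, ← Submodule.mem_comap, hW, hWblock]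
    exact ⟨fun h => ⟨congrArg WithLp.fst h, congrArg WithLp.snd h⟩,
      fun h => congrArg (WithLp.toLp 2) (Prod.ext h.1 h.2)⟩
  · rw [← hsurj f f' u₁ u₂, ← Submodule.mem_comap, hW'', hWadj]
    exact ⟨fun h => ⟨congrArg WithLp.fst h, congrArg WithLp.snd h⟩,
      fun h => congrArg (WithLp.toLp 2) (Prod.ext h.1 h.2)⟩

end ScatteringOperator

/-! ### The operator pencil and its invertibility -/

section Pencil

variable {H : Type*} [NormedAddCommGroup H] [InnerProductSpace ℂ H]

theorem isUnit_of_bijective [CompleteSpace H] (T : H →L[ℂ] H) (hT : Function.Bijective T) :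
    IsUnit T := by
  let e := ContinuousLinearEquiv.ofBijective T (LinearMap.ker_eq_bot.2 hT.1)
    (LinearMap.range_eq_top.2 hT.2)
  exact ⟨ContinuousLinearEquiv.toUnit e, rfl⟩

/-- The Fredholm alternative for perturbations of the identity of finite rank. -/
theorem isUnit_one_sub_of_injective [CompleteSpace H] (K : H →L[ℂ] H)
    (hK : FiniteDimensional ℂ (LinearMap.range (K : H →ₗ[ℂ] H)))
    (hinj : ∀ f, (1 - K) f = 0 → f = 0) : IsUnit (1 - K) := by
  have hinj' : Function.Injective (1 - K : H →L[ℂ] H) := (injective_iff_map_eq_zero _).2 hinj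
  refine isUnit_of_bijective _ ⟨hinj', fun y => ?_⟩
  let R := LinearMap.range (K : H →ₗ[ℂ] H)
  have hR : ∀ f ∈ R, ((1 - K : H →L[ℂ] H) : H →ₗ[ℂ] H) f ∈ R := fun f hf =>
    R.sub_mem hf ⟨f, rfl⟩
  let T : R →ₗ[ℂ] R := ((1 - K : H →L[ℂ] H) : H →ₗ[ℂ] H).restrict hR
  have hTinj : Function.Injective T := fun a b hab => Subtype.ext (hinj' (congrArg Subtype.val hab))
  -- If `(1 - K) r = K y` with `r` in the range of `K`, then `(1 - K) (y + r) = y`.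
  obtain ⟨r, hr⟩ := LinearMap.surjective_of_injective hTinj ⟨K y, ⟨y, rfl⟩⟩
  have hr' : (1 - K) (r : H) = K y := congrArg Subtype.val hr
  refine ⟨y + r, ?_⟩
  rw [map_add, hr']
  simp

/-- The pencil `(P₊ + z P₋) - A (z P₊ + P₋)`. -/
def pencil (J A : H →L[ℂ] H) (z : ℂ) : H →L[ℂ] H :=
  (posProj J + z • negProj J) - A * (z • posProj J + negProj J)

theorem pencil_apply (J A : H →L[ℂ] H) (z : ℂ) (f : H) :
    pencil J A z f =
      (posProj J f + z • negProj J f) - A (z • posProj J f + negProj J f) := rfl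

/-- A scalar minus a product: in this form the adjoint of the pencil differs from the pencil of the
adjoint only by the order of the factors. -/
theorem pencil_eq_smul_one_sub (J A : H →L[ℂ] H) (z : ℂ) :
    pencil J A z = (1 + z) • 1 - (1 + A) * (z • posProj J + negProj J) := by
  ext f
  rw [pencil_apply]
  simp only [sub_apply, smul_apply, add_apply, one_apply_eq_self,
    mul_apply_eq_comp, posProj_eq]
  module

/-- Isolates the part that factors through `negProj J` and so has finite rank. -/
theorem pencil_eq_sub_comp_negProj (J A : H →L[ℂ] H) (z : ℂ) :
    pencil J A z = 1 - z • A - ((1 - z) • (1 + A)) * negProj J := by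
  ext f
  rw [pencil_apply]
  simp only [sub_apply, smul_apply, add_apply, one_apply_eq_self,
    mul_apply_eq_comp, posProj_eq, map_add, map_sub, map_smul]
  module

theorem differentiable_pencil (J A : H →L[ℂ] H) : Differentiable ℂ (pencil J A) := by
  unfold pencil
  fun_prop

variable [CompleteSpace H] {J : H →L[ℂ] H} {κ : ℕ}

/-- Since `‖z A‖ < 1`, the operator `1 - z A` is invertible by a Neumann series; factoring it out
leaves the identity minus a finite rank operator, where the Fredholm alternative applies. -/
theorem isUnit_pencil_of_injective (hJ : IsPontryaginSymmetry J κ) {A : H →L[ℂ] H}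
    (hA : ‖A‖ ≤ 1) {z : ℂ} (hz : ‖z‖ < 1) (hinj : ∀ f, pencil J A z f = 0 → f = 0) :
    IsUnit (pencil J A z) := by
  have hlt : ‖z • A‖ < 1 := by
    rw [norm_smul]
    nlinarith [norm_nonneg z, norm_nonneg A]
  obtain ⟨U, hU⟩ := isUnit_one_sub_of_norm_lt_one hlt
  set K : H →L[ℂ] H := (↑U⁻¹ : H →L[ℂ] H) * ((1 - z) • (1 + A)) * negProj J with hK
  have hfac : pencil J A z = U * (1 - K) := by
    rw [pencil_eq_sub_comp_negProj, ← hU, hK, mul_sub, mul_one, mul_assoc, ← mul_assoc (U : H →L[ℂ] H),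
      Units.mul_inv, one_mul]
  have hfin : FiniteDimensional ℂ (LinearMap.range (K : H →ₗ[ℂ] H)) := by
    have := hJ.finiteDimensional_range_negProj
    have hr : LinearMap.range (K : H →ₗ[ℂ] H) =
        (LinearMap.range (negProj J : H →ₗ[ℂ] H)).map
          (((↑U⁻¹ : H →L[ℂ] H) * ((1 - z) • (1 + A)) : H →L[ℂ] H) : H →ₗ[ℂ] H) := by
      rw [← LinearMap.range_comp]; rfl
    rw [hr]
    infer_instance
  rw [hfac]
  refine U.isUnit.mul (isUnit_one_sub_of_injective K hfin fun f hf => hinj f ?_)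
  rw [hfac, mul_apply_eq_comp, hf, map_zero]

/-- Products `X Y` and `Y X` have the same nonzero spectrum, and the relevant spectral point `1 +
z̄` is nonzero because `|z| < 1`. -/
theorem isUnit_pencil_adjoint_iff (hJ : IsPontryaginSymmetry J κ) (A : H →L[ℂ] H) {z : ℂ}
    (hz : ‖z‖ < 1) :
    IsUnit (pencil J (ContinuousLinearMap.adjoint A) (conj z)) ↔ IsUnit (pencil J A z) := by
  set A' := ContinuousLinearMap.adjoint A with hA'
  have hstar : star (pencil J A z) =
      (1 + conj z) • 1 - (conj z • posProj J + negProj J) * (1 + A') := by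
    rw [pencil_eq_smul_one_sub, star_sub, star_smul, star_one, star_mul, star_add, star_add,
      star_add, star_smul, star_one, star_one]
    congr 1
    simp only [ContinuousLinearMap.star_eq_adjoint, hJ.adjoint_posProj, hJ.adjoint_negProj]
    simp [hA']
  have hne : (1 + conj z) ≠ 0 := by
    intro h
    have : conj z = -1 := by linear_combination h
    have h2 : ‖conj z‖ = 1 := by rw [this]; simp
    rw [RCLike.norm_conj] at h2
    linarith
  have hiff : ∀ a b : H →L[ℂ] H, IsUnit ((1 + conj z) • (1 : H →L[ℂ] H) - a * b) ↔
      (1 + conj z) ∉ spectrum ℂ (a * b) := by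
    intro a b
    rw [spectrum.notMem_iff, Algebra.algebraMap_eq_smul_one]
  have hswap := spectrum.nonzero_mul_comm (𝕜 := ℂ) (1 + A') (conj z • posProj J + negProj J)
  have h1 := Set.ext_iff.1 hswap (1 + conj z)
  simp only [Set.mem_sdiff, Set.mem_singleton_iff, hne, not_false_eq_true, and_true] at h1
  rw [← isUnit_star (a := pencil J A z), hstar, pencil_eq_smul_one_sub, hiff, hiff, h1]

theorem differentiableAt_inverse_pencil {A : H →L[ℂ] H} {z : ℂ}
    (h : IsUnit (pencil J A z)) : DifferentiableAt ℂ (fun z => Ring.inverse (pencil J A z)) z :=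
  (differentiableAt_inverse h).comp z (differentiable_pencil J A z)

theorem isOpen_isUnit_pencil (J A : H →L[ℂ] H) : IsOpen {z | IsUnit (pencil J A z)} :=
  Units.isOpen.preimage (differentiable_pencil J A).continuous

omit [CompleteSpace H] in
theorem pencil_inverse_apply {A : H →L[ℂ] H} {z : ℂ} (h : IsUnit (pencil J A z)) (f : H) :
    pencil J A z (Ring.inverse (pencil J A z) f) = f :=
  congrArg (fun T : H →L[ℂ] H => T f) (Ring.mul_inverse_cancel _ h)

omit [CompleteSpace H] in
theorem inverse_pencil_apply {A : H →L[ℂ] H} {z : ℂ} (h : IsUnit (pencil J A z)) (f : H) :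
    Ring.inverse (pencil J A z) (pencil J A z f) = f :=
  congrArg (fun T : H →L[ℂ] H => T f) (Ring.inverse_mul_cancel _ h)

omit [CompleteSpace H] in
theorem eq_inverse_pencil_iff {A : H →L[ℂ] H} {z : ℂ} (h : IsUnit (pencil J A z)) (f g : H) :
    f = Ring.inverse (pencil J A z) g ↔ pencil J A z f = g := by
  constructor
  · rintro rfl; exact pencil_inverse_apply h g
  · rintro rfl; exact (inverse_pencil_apply h f).symm

end Pencil

/-! ### Resolvents of relations -/

section ResolventRel

variable {H : Type*} [NormedAddCommGroup H] [InnerProductSpace ℂ H]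

theorem isResolventAt_iff {T : Submodule ℂ (H × H)} {z : ℂ} {R : H →L[ℂ] H} :
    IsResolventAt T z R ↔ ∀ f g, (f, g + z • f) ∈ T ↔ f = R g := by
  rw [IsResolventAt, SetLike.ext_iff]
  constructor
  · intro h f g
    rw [← mem_shiftRel, ← mem_invRel, ← h (g, f), LinearMap.mem_graph_iff]
    rfl
  · rintro h ⟨g, f⟩
    rw [mem_invRel, mem_shiftRel, h, LinearMap.mem_graph_iff]
    rfl

theorem notMem_pointSpectrum_of_mem_resolventSetRel {T : Submodule ℂ (H × H)} {z : ℂ}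
    (hz : z ∈ resolventSetRel T) : z ∉ pointSpectrum T := by
  rintro ⟨f, hf, hT⟩
  obtain ⟨R, hR⟩ := hz
  refine hf ?_
  rw [(isResolventAt_iff.1 hR f 0).1 (by simpa using hT), map_zero]

end ResolventRel

/-! ### The extensions `V₁`, `V₂` and their resolvent sets -/

section Extensions

variable {H L₁ L₂ : Type*}
  [NormedAddCommGroup H] [InnerProductSpace ℂ H] [CompleteSpace H]
  [NormedAddCommGroup L₁] [InnerProductSpace ℂ L₁] [CompleteSpace L₁]
  [NormedAddCommGroup L₂] [InnerProductSpace ℂ L₂] [CompleteSpace L₂]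
  {J : H →L[ℂ] H} {κ : ℕ} {V : Submodule ℂ (H × H)} {Γ : Submodule ℂ ((H × H) × (L₁ × L₂))}
  {A : H →L[ℂ] H} {B : L₁ →L[ℂ] H} {C : H →L[ℂ] L₂} {D : L₁ →L[ℂ] L₂}

omit [CompleteSpace H] [CompleteSpace L₁] [CompleteSpace L₂] in
theorem IsUnitaryBoundaryPair.mem_iff (hΓ : IsUnitaryBoundaryPair J V Γ) (f f' : H) :
    (f, f') ∈ V ↔ ((f, f'), ((0 : L₁), (0 : L₂))) ∈ Γ := by
  rw [← hΓ.ker_eq, mem_kerRel]; rfl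

omit [CompleteSpace H] [CompleteSpace L₁] [CompleteSpace L₂] in
theorem IsUnitaryBoundaryPair.indef_sub (hΓ : IsUnitaryBoundaryPair J V Γ)
    {f f' g g' : H} {u₁ v₁ : L₁} {u₂ v₂ : L₂}
    (hf : ((f, f'), (u₁, u₂)) ∈ Γ) (hg : ((g, g'), (v₁, v₂)) ∈ Γ) :
    indef J f g - indef J f' g' = inner ℂ v₁ u₁ - inner ℂ v₂ u₂ :=
  hΓ.green _ hf _ hg

namespace IsScatteringBlock

section Membership

variable (hS : IsScatteringBlock J Γ A B C D)
include hS

theorem mem_ext₁_iff (f f' : H) : (f, f') ∈ ext₁ Γ ↔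
    posProj J f + negProj J f' = A (posProj J f' + negProj J f) := by
  rw [mem_ext₁]
  simp only [hS.mem_iff, map_zero, add_zero]
  exact ⟨fun ⟨_, h, _⟩ => h, fun h => ⟨_, h, rfl⟩⟩

theorem mem_ext₂_iff (f f' : H) : (f, f') ∈ ext₂ Γ ↔
    posProj J f' + negProj J f =
      ContinuousLinearMap.adjoint A (posProj J f + negProj J f') := by
  rw [mem_ext₂]
  simp only [hS.mem_iff_adjoint, map_zero, add_zero]
  exact ⟨fun ⟨_, h, _⟩ => h, fun h => ⟨_, h, rfl⟩⟩

theorem isClosed_ext₁ : IsClosed (ext₁ Γ : Set (H × H)) := by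
  have : (ext₁ Γ : Set (H × H)) =
      {p | posProj J p.1 + negProj J p.2 = A (posProj J p.2 + negProj J p.1)} :=
    Set.ext fun p => hS.mem_ext₁_iff p.1 p.2
  rw [this]
  exact isClosed_eq (by fun_prop) (by fun_prop)

theorem isClosed_ext₂ : IsClosed (ext₂ Γ : Set (H × H)) := by
  have : (ext₂ Γ : Set (H × H)) = {p | posProj J p.2 + negProj J p.1 =
      ContinuousLinearMap.adjoint A (posProj J p.1 + negProj J p.2)} :=
    Set.ext fun p => hS.mem_ext₂_iff p.1 p.2
  rw [this]
  exact isClosed_eq (by fun_prop) (by fun_prop)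

theorem mem_iff_of_coords (hJ : IsPontryaginSymmetry J κ) (a b : H) (u₁ : L₁) (u₂ : L₂) :
    ((posProj J b + negProj J a, posProj J a + negProj J b), (u₁, u₂)) ∈ Γ ↔
      b = A a + B u₁ ∧ u₂ = C a + D u₁ := by
  rw [hS.mem_iff, hJ.posProj_add, hJ.posProj_add, hJ.negProj_add, hJ.negProj_add,
    posProj_add_negProj, posProj_add_negProj]

/-- In the coordinates `(a, b)` the extension `V₁` is the graph `b = A a`, while `V₂` is `a = A* b`;
these are orthogonal companions for the form `(b, b') - (a, a')`. -/
theorem ext₁_eq_invRel_adjRel_ext₂ (hJ : IsPontryaginSymmetry J κ) :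
    ext₁ Γ = invRel (adjRel J (ext₂ Γ)) := by
  ext ⟨h, k⟩
  rw [mem_invRel]
  have hform : (k, h) ∈ adjRel J (ext₂ Γ) ↔ ∀ q ∈ ext₂ Γ, indef J h q.1 - indef J k q.2 = 0 :=
    ⟨fun hk q hq => sub_eq_zero.2 (hk q hq), fun hk q hq => sub_eq_zero.1 (hk q hq)⟩
  rw [hform, hS.mem_ext₁_iff]
  constructor
  · rintro hhk ⟨f, g⟩ hfg
    rw [hS.mem_ext₂_iff] at hfg
    rw [hJ.indef_sub_indef, hhk, hfg, ContinuousLinearMap.adjoint_inner_left, sub_self]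
  · intro hhk
    refine ext_inner_left ℂ fun b => ?_
    -- The element of `V₂` with coordinates `(A* b, b)`, where `b` is an arbitrary test vector.
    have hmem : (posProj J b + negProj J (ContinuousLinearMap.adjoint A b),
        posProj J (ContinuousLinearMap.adjoint A b) + negProj J b) ∈ ext₂ Γ := by
      rw [hS.mem_ext₂_iff, hJ.posProj_add, hJ.posProj_add, hJ.negProj_add, hJ.negProj_add,
        posProj_add_negProj, posProj_add_negProj]
    have := hhk _ hmem
    rw [hJ.indef_sub_indef, hJ.posProj_add, hJ.posProj_add, hJ.negProj_add, hJ.negProj_add,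
        posProj_add_negProj, posProj_add_negProj, ContinuousLinearMap.adjoint_inner_left] at this
    exact sub_eq_zero.1 this

/-- The Green identity with `u₁ = 0` reads `‖A a‖² + ‖C a‖² = ‖a‖²`. -/
theorem norm_le_one (hJ : IsPontryaginSymmetry J κ) (hΓ : IsUnitaryBoundaryPair J V Γ) :
    ‖A‖ ≤ 1 := by
  refine ContinuousLinearMap.opNorm_le_bound _ zero_le_one fun a => ?_
  have hmem : ((posProj J (A a) + negProj J a, posProj J a + negProj J (A a)),
      ((0 : L₁), C a)) ∈ Γ := by
    rw [hS.mem_iff_of_coords hJ]; simp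
  have h := hΓ.indef_sub hmem hmem
  rw [hJ.indef_sub_indef, hJ.posProj_add, hJ.posProj_add, hJ.negProj_add, hJ.negProj_add,
    posProj_add_negProj, posProj_add_negProj, inner_zero_left, inner_self_eq_norm_sq_to_K,
    inner_self_eq_norm_sq_to_K, inner_self_eq_norm_sq_to_K] at h
  have h' : ‖A a‖ ^ 2 - ‖a‖ ^ 2 = -‖C a‖ ^ 2 := by
    rw [zero_sub] at h
    exact_mod_cast h
  rw [one_mul]
  exact abs_le_of_sq_le_sq' (by nlinarith [sq_nonneg ‖C a‖]) (norm_nonneg _) |>.2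

theorem add_smul_mem_ext₁_iff (z : ℂ) (f g : H) : (f, g + z • f) ∈ ext₁ Γ ↔
    pencil J A z f = A (posProj J g) - negProj J g := by
  rw [hS.mem_ext₁_iff, pencil_apply, ← sub_eq_zero, ← sub_eq_zero (b := A (posProj J g) - _)]
  refine Eq.congr ?_ rfl
  simp only [map_add, map_smul]
  abel

/-- Dividing the equation of `V₂` by `z` moves the exterior point to `z⁻¹` in the disk, so the
pencil results apply to `A*`. -/
theorem add_smul_mem_ext₂_iff {z : ℂ} (hz : z ≠ 0) (f g : H) : (f, g + z • f) ∈ ext₂ Γ ↔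
    pencil J (ContinuousLinearMap.adjoint A) z⁻¹ f =
      z⁻¹ • (ContinuousLinearMap.adjoint A (negProj J g) - posProj J g) := by
  rw [hS.mem_ext₂_iff, pencil_apply, ← sub_eq_zero, ← sub_eq_zero (b := z⁻¹ • _),
    ← smul_eq_zero_iff_right (inv_ne_zero hz)]
  refine Eq.congr ?_ rfl
  simp only [map_add, map_smul, smul_sub, smul_add, smul_smul, inv_mul_cancel₀ hz, one_smul]
  abel

theorem isResolventAt_ext₁ {z : ℂ} (h : IsUnit (pencil J A z)) :
    IsResolventAt (ext₁ Γ) z (Ring.inverse (pencil J A z) * (A * posProj J - negProj J)) := by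
  rw [isResolventAt_iff]
  intro f g
  rw [hS.add_smul_mem_ext₁_iff, mul_apply_eq_comp, eq_inverse_pencil_iff h]
  rfl

theorem isResolventAt_ext₂ {z : ℂ} (hz : z ≠ 0)
    (h : IsUnit (pencil J (ContinuousLinearMap.adjoint A) z⁻¹)) :
    IsResolventAt (ext₂ Γ) z (Ring.inverse (pencil J (ContinuousLinearMap.adjoint A) z⁻¹) *
      (z⁻¹ • (ContinuousLinearMap.adjoint A * negProj J - posProj J))) := by
  rw [isResolventAt_iff]
  intro f g
  rw [hS.add_smul_mem_ext₂_iff hz, mul_apply_eq_comp, eq_inverse_pencil_iff h]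
  rfl

end Membership

variable (hJ : IsPontryaginSymmetry J κ) (hΓ : IsUnitaryBoundaryPair J V Γ)
  (hS : IsScatteringBlock J Γ A B C D)
include hJ hΓ hS

/-- Kernel vectors of the pencil are exactly eigenvectors of `V₁`, and in the disk injectivity of
the pencil already gives invertibility. -/
theorem isUnit_pencil_iff_notMem_pointSpectrum_ext₁ {z : ℂ} (hz : ‖z‖ < 1) :
    IsUnit (pencil J A z) ↔ z ∉ pointSpectrum (ext₁ Γ) := by
  refine ⟨fun h => notMem_pointSpectrum_of_mem_resolventSetRel ⟨_, hS.isResolventAt_ext₁ h⟩,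
    fun h => ?_⟩
  refine isUnit_pencil_of_injective hJ (hS.norm_le_one hJ hΓ) hz fun f hf => ?_
  by_contra hne
  refine h ⟨f, hne, ?_⟩
  have := (hS.add_smul_mem_ext₁_iff z f 0).2 (by simpa using hf)
  simpa using this

theorem isUnit_pencil_iff_notMem_pointSpectrum_ext₂ {z : ℂ} (hz : 1 < ‖z‖) :
    IsUnit (pencil J (ContinuousLinearMap.adjoint A) z⁻¹) ↔ z ∉ pointSpectrum (ext₂ Γ) := by
  have hz0 : z ≠ 0 := norm_pos_iff.1 (by linarith)
  refine ⟨fun h => notMem_pointSpectrum_of_mem_resolventSetRel ⟨_, hS.isResolventAt_ext₂ hz0 h⟩,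
    fun h => ?_⟩
  refine isUnit_pencil_of_injective hJ
    ((LinearIsometryEquiv.norm_map ContinuousLinearMap.adjoint A).trans_le
      (hS.norm_le_one hJ hΓ)) (by rw [norm_inv]; exact inv_lt_one_of_one_lt₀ hz) fun f hf => ?_
  by_contra hne
  refine h ⟨f, hne, ?_⟩
  have := (hS.add_smul_mem_ext₂_iff hz0 f 0).2 (by simpa using hf)
  simpa using this

theorem innerDomain_eq_sdiff :
    innerDomain Γ = {z : ℂ | ‖z‖ < 1} \ pointSpectrum (ext₁ Γ) := by
  ext z
  refine ⟨fun h => ⟨h.2, notMem_pointSpectrum_of_mem_resolventSetRel h.1⟩, fun h => ⟨?_, h.1⟩⟩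
  exact ⟨_, hS.isResolventAt_ext₁
    ((isUnit_pencil_iff_notMem_pointSpectrum_ext₁ hJ hΓ hS h.1).2 h.2)⟩

theorem outerDomain_eq_sdiff :
    outerDomain Γ = {z : ℂ | 1 < ‖z‖} \ pointSpectrum (ext₂ Γ) := by
  ext z
  refine ⟨fun h => ⟨h.2, notMem_pointSpectrum_of_mem_resolventSetRel h.1⟩, fun h => ⟨?_, h.1⟩⟩
  have hz0 : z ≠ 0 := norm_pos_iff.1 (by linarith [show 1 < ‖z‖ from h.1])
  exact ⟨_, hS.isResolventAt_ext₂ hz0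
    ((isUnit_pencil_iff_notMem_pointSpectrum_ext₂ hJ hΓ hS h.1).2 h.2)⟩

theorem mem_innerDomain_iff {z : ℂ} :
    z ∈ innerDomain Γ ↔ ‖z‖ < 1 ∧ IsUnit (pencil J A z) := by
  rw [innerDomain_eq_sdiff hJ hΓ hS]
  exact and_congr_right fun hz =>
    (isUnit_pencil_iff_notMem_pointSpectrum_ext₁ hJ hΓ hS hz).symm

theorem mem_outerDomain_iff {z : ℂ} :
    z ∈ outerDomain Γ ↔
      1 < ‖z‖ ∧ IsUnit (pencil J (ContinuousLinearMap.adjoint A) z⁻¹) := by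
  rw [outerDomain_eq_sdiff hJ hΓ hS]
  exact and_congr_right fun hz =>
    (isUnit_pencil_iff_notMem_pointSpectrum_ext₂ hJ hΓ hS hz).symm

theorem isUnit_pencil_adjoint {z : ℂ} (hz : z ∈ innerDomain Γ) :
    IsUnit (pencil J (ContinuousLinearMap.adjoint A) (conj z)) := by
  obtain ⟨h1, h2⟩ := (mem_innerDomain_iff hJ hΓ hS).1 hz
  exact (isUnit_pencil_adjoint_iff hJ A h1).2 h2

theorem outerDomain_eq :
    outerDomain Γ = {z : ℂ | 1 < ‖z‖ ∧ 1 / conj z ∈ innerDomain Γ} := by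
  ext z
  rw [mem_outerDomain_iff hJ hΓ hS, Set.mem_ofPred_eq, mem_innerDomain_iff hJ hΓ hS]
  refine and_congr_right fun hz => ?_
  have hlt : ‖1 / conj z‖ < 1 := by
    rw [one_div, norm_inv, RCLike.norm_conj]; exact inv_lt_one_of_one_lt₀ hz
  rw [← isUnit_pencil_adjoint_iff hJ A hlt]
  rw [and_iff_right hlt, one_div, map_inv₀, Complex.conj_conj]

theorem isOpen_innerDomain : IsOpen (innerDomain Γ) := by
  have : innerDomain Γ = {z : ℂ | ‖z‖ < 1} ∩ {z | IsUnit (pencil J A z)} :=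
    Set.ext fun z => mem_innerDomain_iff hJ hΓ hS
  rw [this]
  exact (isOpen_lt continuous_norm continuous_const).inter (isOpen_isUnit_pencil J A)

theorem isOpen_outerDomain : IsOpen (outerDomain Γ) := by
  rw [outerDomain_eq hJ hΓ hS]
  have h1 : IsOpen {z : ℂ | 1 < ‖z‖} := isOpen_lt continuous_const continuous_norm
  have h2 : ContinuousOn (fun z : ℂ => 1 / conj z) {z : ℂ | 1 < ‖z‖} := by
    refine continuousOn_const.div (RCLike.continuous_conj (K := ℂ)).continuousOn fun z hz => ?_
    have hz0 : z ≠ 0 := norm_pos_iff.1 (by linarith [show 1 < ‖z‖ from hz])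
    simpa using hz0
  exact h2.isOpen_inter_preimage h1 (isOpen_innerDomain hJ hΓ hS)

end IsScatteringBlock

end Extensions

/-! ### Counting the exceptional points -/

section ExceptionalPoints

variable {H L₁ L₂ : Type*}
  [NormedAddCommGroup H] [InnerProductSpace ℂ H] [CompleteSpace H]
  [NormedAddCommGroup L₁] [InnerProductSpace ℂ L₁] [CompleteSpace L₁]
  [NormedAddCommGroup L₂] [InnerProductSpace ℂ L₂] [CompleteSpace L₂]
  {J : H →L[ℂ] H} {κ : ℕ} {V : Submodule ℂ (H × H)} {Γ : Submodule ℂ ((H × H) × (L₁ × L₂))}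

/-- `negProj J ∘ T` maps into a space of dimension `κ`. Used both for the eigenvalues of `V₁` and
for the negative eigenvalues of Gram matrices. -/
theorem IsPontryaginSymmetry.exists_ne_zero_negProj_eq_zero (hJ : IsPontryaginSymmetry J κ)
    {E : Type*} [AddCommGroup E] [Module ℂ E] [FiniteDimensional ℂ E] (T : E →ₗ[ℂ] H)
    (hE : κ < Module.finrank ℂ E) : ∃ c, c ≠ 0 ∧ negProj J (T c) = 0 := by
  have := hJ.finite_neg
  let N : E →ₗ[ℂ] LinearMap.ker ((J + 1 : H →L[ℂ] H) : H →ₗ[ℂ] H) :=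
    ((negProj J : H →ₗ[ℂ] H) ∘ₗ T).codRestrict _ fun c => hJ.negProj_mem (T c)
  have hN : LinearMap.ker N ≠ ⊥ := N.ker_ne_bot_of_finrank_lt (by rwa [hJ.finrank_neg])
  obtain ⟨c, hc, hc0⟩ := (Submodule.ne_bot_iff _).1 hN
  exact ⟨c, hc0, congrArg Subtype.val (LinearMap.mem_ker.1 hc)⟩

-- Vandermonde, made scalar by pairing with the vector `y i` itself.
omit [CompleteSpace H] in
theorem eq_zero_of_forall_sum_pow_smul_eq_zero {n : ℕ} {l : Fin n → ℂ}
    (hl : Function.Injective l) {y : Fin n → H} (h : ∀ k : ℕ, ∑ i, l i ^ k • y i = 0) (i : Fin n) :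
    y i = 0 := by
  have h0 : (fun j => inner ℂ (y i) (y j)) = 0 := by
    refine Matrix.eq_zero_of_forall_pow_sum_mul_pow_eq_zero hl fun k => ?_
    have := congrArg (fun v => inner ℂ (y i) v) (h k)
    simp only [inner_sum, inner_smul_right, inner_zero_right] at this
    rw [← this]
    exact Finset.sum_congr rfl fun j _ => mul_comm _ _
  exact inner_self_eq_zero.1 (congrFun h0 i)

-- From more than `κ` eigenvectors form a combination `x 0` with vanishing negative part. The form
-- along the iterates `x k` is nondecreasing with limit `0`, yet starts at `‖P₊ x 0‖² ≥ 0`, so it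
-- vanishes identically. Then `w k = 0`, the iterates lie in the single-valued `V`, and all of them
-- are zero.
omit [CompleteSpace L₁] [CompleteSpace L₂] in
theorem card_le_of_mem_pointSpectrum (hJ : IsPontryaginSymmetry J κ)
    (hV : IsClosedIsometricOperator J V) (hΓ : IsUnitaryBoundaryPair J V Γ)
    {n : ℕ} {l : Fin n → ℂ} (hl : Function.Injective l) (hlt : ∀ i, ‖l i‖ < 1)
    (hmem : ∀ i, l i ∈ pointSpectrum (ext₁ Γ)) : n ≤ κ := by
  by_contra! hn
  choose f hf0 hf using hmem
  simp only [mem_ext₁] at hf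
  choose u hu using hf
  obtain ⟨c, hc0, hc⟩ := hJ.exists_ne_zero_negProj_eq_zero (Fintype.linearCombination ℂ f)
    (by simpa using hn)
  rw [Fintype.linearCombination_apply] at hc
  set x : ℕ → H := fun k => ∑ i, l i ^ k • c i • f i with hx
  set w : ℕ → L₂ := fun k => ∑ i, l i ^ k • c i • u i with hw
  have hxw : ∀ k, ((x k, x (k + 1)), ((0 : L₁), w k)) ∈ Γ := by
    intro k
    have : ((x k, x (k + 1)), ((0 : L₁), w k)) =
        ∑ i, l i ^ k • c i • ((f i, l i • f i), ((0 : L₁), u i)) := by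
      refine Prod.ext (Prod.ext ?_ ?_) (Prod.ext ?_ ?_)
      · simp [hx, Prod.fst_sum]
      · simp only [hx, Prod.snd_sum, Prod.fst_sum, Prod.smul_fst, Prod.smul_snd, pow_succ]
        exact Finset.sum_congr rfl fun i _ => by module
      · simp [Prod.snd_sum, Prod.fst_sum]
      · simp [hw, Prod.snd_sum]
    rw [this]
    exact Submodule.sum_mem _ fun i _ => Γ.smul_mem _ (Γ.smul_mem _ (hu i))
  set q : ℕ → ℝ := fun k => (indef J (x k) (x k)).re with hq
  have hstep : ∀ k, q k - q (k + 1) = -‖w k‖ ^ 2 := by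
    intro k
    have h := congrArg Complex.re (hΓ.indef_sub (hxw k) (hxw k))
    rw [inner_zero_left, zero_sub, inner_self_eq_norm_sq_to_K, Complex.sub_re] at h
    rw [hq]
    simp only
    rw [h]
    norm_cast
  have hmono : Monotone q := monotone_nat_of_le_succ fun k => by
    nlinarith [hstep k, sq_nonneg ‖w k‖]
  have hx0 : Tendsto x atTop (𝓝 0) := by
    have : Tendsto x atTop (𝓝 (∑ i, (0 : ℂ) • c i • f i)) :=
      tendsto_finsetSum _ fun i _ =>
        (tendsto_pow_atTop_nhds_zero_of_norm_lt_one (hlt i)).smul_const _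
    simpa using this
  have hq0 : Tendsto q atTop (𝓝 0) := by
    have hcont : Continuous fun f : H => (indef J f f).re := by
      unfold indef
      fun_prop
    have h := (hcont.tendsto 0).comp hx0
    have h2 : (indef J (0 : H) 0).re = 0 := by simp [indef]
    rw [h2] at h
    exact h
  have hle : ∀ k, q k ≤ 0 := fun k => hmono.ge_of_tendsto hq0 k
  have hnegx : negProj J (x 0) = 0 := by simpa [hx] using hc
  have hq_zero : q 0 = ‖posProj J (x 0)‖ ^ 2 := by
    rw [hq]
    simp only
    rw [hJ.re_indef_self, hnegx]
    simp
  have hall : ∀ k, q k = 0 := fun k => le_antisymm (hle k)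
    ((by rw [hq_zero]; positivity : 0 ≤ q 0).trans (hmono (Nat.zero_le k)))
  have hw0 : ∀ k, w k = 0 := fun k => by
    have := hstep k
    rw [hall, hall] at this
    have h2 : ‖w k‖ ^ 2 = 0 := by linarith
    exact norm_eq_zero.1 (pow_eq_zero_iff two_ne_zero |>.1 h2)
  have hxV : ∀ k, (x k, x (k + 1)) ∈ V := fun k => by
    rw [hΓ.mem_iff, ← hw0 k]
    exact hxw k
  have hxz : ∀ k, x k = 0 := by
    intro k
    induction k with
    -- Here both parts vanish: the negative one by the choice of `c`, the positive one since `q 0 =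
    -- 0`.
    | zero =>
      have h2 : ‖x 0‖ ^ 2 = 0 := by
        rw [hJ.norm_sq_eq_add, ← hq_zero, hall, hnegx]
        simp
      exact norm_eq_zero.1 (pow_eq_zero_iff two_ne_zero |>.1 h2)
    | succ k ih =>
      have h := hxV k
      rw [ih, ← mem_mulRel, hV.singleValued] at h
      exact h
  refine hc0 (funext fun i => ?_)
  have := eq_zero_of_forall_sum_pow_smul_eq_zero hl hxz i
  exact (smul_eq_zero.1 this).resolve_right (hf0 i)

theorem encard_le_of_forall_injective {s : Set ℂ} {k : ℕ}
    (h : ∀ (n : ℕ) (l : Fin n → ℂ), Function.Injective l → (∀ i, l i ∈ s) → n ≤ k) :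
    s.encard ≤ k := by
  by_contra! hlt
  obtain ⟨t, hts, ht⟩ := Set.exists_subset_encard_eq (Order.add_one_le_of_lt hlt)
  have htfin : t.Finite := Set.finite_of_encard_eq_coe (k := k + 1) (by exact_mod_cast ht)
  have hcard : htfin.toFinset.card = k + 1 := by
    rw [htfin.encard_eq_coe_toFinset_card] at ht
    exact_mod_cast ht
  have := h (k + 1) (fun i => (htfin.toFinset.equivFinOfCardEq hcard).symm i)
    (Subtype.val_injective.comp (Equiv.injective _))
    (fun i => hts (htfin.mem_toFinset.1 ((htfin.toFinset.equivFinOfCardEq hcard).symm i).2))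
  omega

theorem mem_closure_of_finite_sdiff {s : Set ℂ} (hs : ({z : ℂ | ‖z‖ < 1} \ s).Finite) {z : ℂ}
    (hz : ‖z‖ < 1) : z ∈ closure s := by
  have hopen : IsOpen {z : ℂ | ‖z‖ < 1} := isOpen_lt continuous_norm continuous_const
  refine closure_mono ?_ ((hs.countable.dense_compl ℂ).open_subset_closure_inter hopen hz)
  exact fun w hw => by_contra fun hn => hw.2 ⟨hw.1, hn⟩

namespace IsScatteringBlock

variable {A : H →L[ℂ] H} {B : L₁ →L[ℂ] H} {C : H →L[ℂ] L₂} {D : L₁ →L[ℂ] L₂}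
  (hJ : IsPontryaginSymmetry J κ) (hV : IsClosedIsometricOperator J V)
  (hΓ : IsUnitaryBoundaryPair J V Γ) (hS : IsScatteringBlock J Γ A B C D)
include hJ hV hΓ hS

theorem encard_sdiff_innerDomain_le : ({z : ℂ | ‖z‖ < 1} \ innerDomain Γ).encard ≤ κ := by
  refine encard_le_of_forall_injective fun n l hl hmem =>
    card_le_of_mem_pointSpectrum hJ hV hΓ hl (fun i => (hmem i).1) fun i => ?_
  have h := (hmem i).2
  rw [innerDomain_eq_sdiff hJ hΓ hS] at h
  by_contra hn
  exact h ⟨(hmem i).1, hn⟩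

theorem encard_sdiff_outerDomain_le : ({z : ℂ | 1 < ‖z‖} \ outerDomain Γ).encard ≤ κ := by
  have hmaps : Set.MapsTo (fun z : ℂ => 1 / conj z) ({z : ℂ | 1 < ‖z‖} \ outerDomain Γ)
      ({z : ℂ | ‖z‖ < 1} \ innerDomain Γ) := by
    rintro z ⟨hz1, hz2⟩
    refine ⟨?_, fun h => hz2 ?_⟩
    · change ‖1 / conj z‖ < 1
      rw [one_div, norm_inv, RCLike.norm_conj]
      exact inv_lt_one_of_one_lt₀ hz1
    · rw [outerDomain_eq hJ hΓ hS]
      exact ⟨hz1, h⟩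
  refine le_trans (Set.encard_le_encard_of_injOn hmaps fun z _ w _ h => ?_)
    (encard_sdiff_innerDomain_le hJ hV hΓ hS)
  simp only [one_div] at h
  exact (starRingEnd ℂ).injective (inv_injective h)

theorem finite_sdiff_innerDomain : ({z : ℂ | ‖z‖ < 1} \ innerDomain Γ).Finite :=
  Set.finite_of_encard_le_coe (encard_sdiff_innerDomain_le hJ hV hΓ hS)

theorem nonempty_innerDomain : (innerDomain Γ).Nonempty := by
  have h : (0 : ℂ) ∈ closure (innerDomain Γ) :=
    mem_closure_of_finite_sdiff (finite_sdiff_innerDomain hJ hV hΓ hS) (by simp)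
  exact closure_nonempty_iff.1 ⟨0, h⟩

theorem nonempty_outerDomain : (outerDomain Γ).Nonempty := by
  have hfin : ({z : ℂ | 1 < ‖z‖} \ outerDomain Γ).Finite :=
    Set.finite_of_encard_le_coe (encard_sdiff_outerDomain_le hJ hV hΓ hS)
  have hopen : IsOpen {z : ℂ | 1 < ‖z‖} := isOpen_lt continuous_const continuous_norm
  have h : (2 : ℂ) ∈ closure ({z : ℂ | 1 < ‖z‖} ∩ ({z : ℂ | 1 < ‖z‖} \ outerDomain Γ)ᶜ) :=
    (hfin.countable.dense_compl ℂ).open_subset_closure_inter hopen (by simp)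
  obtain ⟨z, hz1, hz2⟩ := closure_nonempty_iff.1 ⟨_, h⟩
  exact ⟨z, by_contra fun hn => hz2 ⟨hz1, hn⟩⟩

end IsScatteringBlock

end ExceptionalPoints

/-! ### γ-fields, Weyl function and the kernel identity -/

section GammaFields

variable {H L₁ L₂ : Type*}
  [NormedAddCommGroup H] [InnerProductSpace ℂ H] [CompleteSpace H]
  [NormedAddCommGroup L₁] [InnerProductSpace ℂ L₁] [CompleteSpace L₁]
  [NormedAddCommGroup L₂] [InnerProductSpace ℂ L₂] [CompleteSpace L₂]
  {J : H →L[ℂ] H} {κ : ℕ} {V : Submodule ℂ (H × H)} {Γ : Submodule ℂ ((H × H) × (L₁ × L₂))}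

/-- The γ-field on the disk. -/
def gammaIn (J A : H →L[ℂ] H) (B : L₁ →L[ℂ] H) (z : ℂ) : L₁ →L[ℂ] H :=
  Ring.inverse (pencil J A z) ∘L B

/-- The γ-field on the exterior of the disk. -/
def gammaOut (J A : H →L[ℂ] H) (C : H →L[ℂ] L₂) (z : ℂ) : L₂ →L[ℂ] H :=
  z⁻¹ • (Ring.inverse (pencil J (ContinuousLinearMap.adjoint A) z⁻¹) ∘L
    ContinuousLinearMap.adjoint C)

/-- The field `z ↦ z̄⁻¹ γ₂(1 / z̄)`, which is regular at the origin. -/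
def gammaDual (J A : H →L[ℂ] H) (C : H →L[ℂ] L₂) (z : ℂ) : L₂ →L[ℂ] H :=
  Ring.inverse (pencil J (ContinuousLinearMap.adjoint A) (conj z)) ∘L
    ContinuousLinearMap.adjoint C

/-- The Weyl function as the transfer function of the scattering blocks. -/
def transferFun (J A : H →L[ℂ] H) (B : L₁ →L[ℂ] H) (C : H →L[ℂ] L₂) (D : L₁ →L[ℂ] L₂) (z : ℂ) :
    L₁ →L[ℂ] L₂ :=
  C ∘L (z • posProj J + negProj J) ∘L gammaIn J A B z + D

omit [CompleteSpace L₁] in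
theorem differentiableAt_gammaIn {A : H →L[ℂ] H} (B : L₁ →L[ℂ] H) {z : ℂ}
    (h : IsUnit (pencil J A z)) : DifferentiableAt ℂ (gammaIn J A B) z :=
  (differentiableAt_inverse_pencil h).clm_comp (differentiableAt_const B)

theorem differentiableAt_gammaOut {A : H →L[ℂ] H} (C : H →L[ℂ] L₂) {z : ℂ} (hz : z ≠ 0)
    (h : IsUnit (pencil J (ContinuousLinearMap.adjoint A) z⁻¹)) :
    DifferentiableAt ℂ (gammaOut J A C) z :=
  (differentiableAt_inv hz).smul
    (((differentiableAt_inverse_pencil h).comp z (differentiableAt_inv hz)).clm_comp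
      (differentiableAt_const _))

omit [CompleteSpace L₁] [CompleteSpace L₂] in
theorem differentiableAt_transferFun {A : H →L[ℂ] H} (B : L₁ →L[ℂ] H) (C : H →L[ℂ] L₂)
    (D : L₁ →L[ℂ] L₂) {z : ℂ} (h : IsUnit (pencil J A z)) :
    DifferentiableAt ℂ (transferFun J A B C D) z := by
  refine ((differentiableAt_const C).clm_comp
    (DifferentiableAt.clm_comp ?_ (differentiableAt_gammaIn B h))).add (differentiableAt_const D)
  fun_prop

theorem gammaOut_eq_smul_gammaDual (A : H →L[ℂ] H) (C : H →L[ℂ] L₂) (z : ℂ) :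
    gammaOut J A C z = z⁻¹ • gammaDual J A C (1 / conj z) := by
  rw [gammaOut, gammaDual, one_div, map_inv₀, Complex.conj_conj]

theorem gammaOut_inv_conj (A : H →L[ℂ] H) (C : H →L[ℂ] L₂) (z : ℂ) :
    gammaOut J A C (conj z)⁻¹ = conj z • gammaDual J A C z := by
  rw [gammaOut, gammaDual, inv_inv]

namespace IsScatteringBlock

variable {A : H →L[ℂ] H} {B : L₁ →L[ℂ] H} {C : H →L[ℂ] L₂} {D : L₁ →L[ℂ] L₂}

section Membership

variable (hS : IsScatteringBlock J Γ A B C D)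
include hS

theorem eigen_mem_iff {z : ℂ} (h : IsUnit (pencil J A z)) (f : H) (u₁ : L₁) (u₂ : L₂) :
    ((f, z • f), (u₁, u₂)) ∈ Γ ↔ f = gammaIn J A B z u₁ ∧ u₂ = transferFun J A B C D z u₁ := by
  have h1 : posProj J f + negProj J (z • f) = A (posProj J (z • f) + negProj J f) + B u₁ ↔
      f = gammaIn J A B z u₁ := by
    rw [gammaIn, ContinuousLinearMap.comp_apply, eq_inverse_pencil_iff h, pencil_apply,
      sub_eq_iff_eq_add', map_smul, map_smul]
  rw [hS.mem_iff, h1]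
  refine and_congr_right fun hf => ?_
  rw [hf, map_smul]
  rfl

theorem eigen_mem_iff_exists_right {z : ℂ} (hz : z ≠ 0)
    (h : IsUnit (pencil J (ContinuousLinearMap.adjoint A) z⁻¹)) (f : H) (u₂ : L₂) :
    (∃ u₁, ((f, z • f), (u₁, u₂)) ∈ Γ) ↔ f = gammaOut J A C z u₂ := by
  simp only [hS.mem_iff_adjoint]
  have h1 : posProj J (z • f) + negProj J f =
      ContinuousLinearMap.adjoint A (posProj J f + negProj J (z • f)) +
        ContinuousLinearMap.adjoint C u₂ ↔ f = gammaOut J A C z u₂ := by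
    rw [gammaOut, smul_apply, ContinuousLinearMap.comp_apply, ← map_smul, eq_inverse_pencil_iff h,
      pencil_apply, ← sub_eq_iff_eq_add', ← sub_eq_zero, ← sub_eq_zero (b := z⁻¹ • _),
      ← smul_eq_zero_iff_right (inv_ne_zero hz)]
    refine Eq.congr ?_ rfl
    simp only [map_add, map_smul, smul_sub, smul_add, smul_smul, inv_mul_cancel₀ hz, one_smul]
  rw [← h1]
  exact ⟨fun ⟨_, h, _⟩ => h, fun h => ⟨_, h, rfl⟩⟩

/-- The pair `(z̄ g, g)` replaces `(f, f / z̄)`, so that `z = 0` needs no exception. -/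
theorem exists_gammaDual_mem {z : ℂ}
    (h : IsUnit (pencil J (ContinuousLinearMap.adjoint A) (conj z))) (u₂ : L₂) :
    ∃ u₁, ((conj z • gammaDual J A C z u₂, gammaDual J A C z u₂), (u₁, u₂)) ∈ Γ := by
  simp only [hS.mem_iff_adjoint]
  refine ⟨_, ?_, rfl⟩
  have := pencil_inverse_apply h (ContinuousLinearMap.adjoint C u₂)
  rw [pencil_apply, sub_eq_iff_eq_add'] at this
  rw [map_smul, map_smul]
  exact this

end Membership

variable (hJ : IsPontryaginSymmetry J κ) (hΓ : IsUnitaryBoundaryPair J V Γ)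
  (hS : IsScatteringBlock J Γ A B C D)
include hJ hΓ hS

theorem gammaIn_mem {z : ℂ} (hz : z ∈ innerDomain Γ) (u₁ : L₁) :
    ((gammaIn J A B z u₁, z • gammaIn J A B z u₁), (u₁, transferFun J A B C D z u₁)) ∈ Γ :=
  (hS.eigen_mem_iff ((mem_innerDomain_iff hJ hΓ hS).1 hz).2 _ _ _).2 ⟨rfl, rfl⟩

theorem gammaDual_mem {z : ℂ} (hz : z ∈ innerDomain Γ) (u₂ : L₂) :
    ((conj z • gammaDual J A C z u₂, gammaDual J A C z u₂),
      (ContinuousLinearMap.adjoint (transferFun J A B C D z) u₂, u₂)) ∈ Γ := by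
  obtain ⟨u₁, hu⟩ := hS.exists_gammaDual_mem (isUnit_pencil_adjoint hJ hΓ hS hz) u₂
  have : u₁ = ContinuousLinearMap.adjoint (transferFun J A B C D z) u₂ := by
    refine ext_inner_left ℂ fun v => ?_
    -- The left side is `[z̄ g, f] - [g, z f] = 0`, which leaves the defining relation of the
    -- adjoint of the Weyl function.
    have h := hΓ.indef_sub hu (gammaIn_mem hJ hΓ hS hz v)
    rw [ContinuousLinearMap.adjoint_inner_right, ← sub_eq_zero, ← h]
    simp only [indef, map_smul, inner_smul_left, inner_smul_right, sub_self]
  rw [← this]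
  exact hu

theorem gammaOut_mem {z : ℂ} (hz : z ∈ outerDomain Γ) (u₂ : L₂) :
    ((gammaOut J A C z u₂, z • gammaOut J A C z u₂),
      (ContinuousLinearMap.adjoint (transferFun J A B C D (1 / conj z)) u₂, u₂)) ∈ Γ := by
  rw [outerDomain_eq hJ hΓ hS] at hz
  have hz0 : z ≠ 0 := norm_pos_iff.1 (by linarith [show 1 < ‖z‖ from hz.1])
  have h := gammaDual_mem hJ hΓ hS hz.2 u₂
  rw [gammaOut_eq_smul_gammaDual, smul_apply, smul_smul, mul_inv_cancel₀ hz0, one_smul]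
  simpa using h

theorem graph_gammaIn {z : ℂ} (hz : z ∈ innerDomain Γ) :
    (gammaIn J A B z : L₁ →ₗ[ℂ] H).graph = gammaRel₁ Γ z := by
  ext ⟨u, f⟩
  rw [mem_gammaRel₁, LinearMap.mem_graph_iff]
  simp only [hS.eigen_mem_iff ((mem_innerDomain_iff hJ hΓ hS).1 hz).2]
  exact ⟨fun h => ⟨_, h, rfl⟩, fun ⟨_, h, _⟩ => h⟩

theorem graph_gammaOut {z : ℂ} (hz : z ∈ outerDomain Γ) :
    (gammaOut J A C z : L₂ →ₗ[ℂ] H).graph = gammaRel₂ Γ z := by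
  obtain ⟨h1, h2⟩ := (mem_outerDomain_iff hJ hΓ hS).1 hz
  have hz0 : z ≠ 0 := norm_pos_iff.1 (by linarith)
  ext ⟨u, f⟩
  rw [mem_gammaRel₂, LinearMap.mem_graph_iff, hS.eigen_mem_iff_exists_right hz0 h2]
  rfl

theorem graph_transferFun {z : ℂ} (hz : z ∈ innerDomain Γ) :
    (transferFun J A B C D z : L₁ →ₗ[ℂ] L₂).graph = weylRel Γ z := by
  ext ⟨u₁, u₂⟩
  rw [mem_weylRel, LinearMap.mem_graph_iff]
  simp only [hS.eigen_mem_iff ((mem_innerDomain_iff hJ hΓ hS).1 hz).2]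
  exact ⟨fun h => ⟨_, rfl, h⟩, fun ⟨_, _, h⟩ => h⟩

theorem gammaIn_eq_add {z w : ℂ} (hz : z ∈ innerDomain Γ) (hw : w ∈ innerDomain Γ) :
    gammaIn J A B z =
      gammaIn J A B w + (z - w) • (resolventRel (ext₁ Γ) z ∘L gammaIn J A B w) := by
  ext u
  have hR := isResolventAt_iff.1 (isResolventAt_resolventRel hz.1)
  -- The `L₁`-components cancel, so the difference lies in `V₁`; its second entry is `(z - w) γ₁(w)
  -- u` plus `z` times its first entry.
  have h := Γ.sub_mem (gammaIn_mem hJ hΓ hS hz u) (gammaIn_mem hJ hΓ hS hw u)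
  simp only [Prod.mk_sub_mk, sub_self] at h
  have h2 := (mem_ext₁ Γ _ _).2 ⟨_, h⟩
  have h3 := (hR (gammaIn J A B z u - gammaIn J A B w u) ((z - w) • gammaIn J A B w u)).1 (by
    convert h2 using 2
    module)
  rw [add_apply, smul_apply, ContinuousLinearMap.comp_apply, ← map_smul, ← h3]
  abel

theorem gammaOut_eq_add {z w : ℂ} (hz : z ∈ outerDomain Γ) (hw : w ∈ outerDomain Γ) :
    gammaOut J A C z =
      gammaOut J A C w + (z - w) • (resolventRel (ext₂ Γ) z ∘L gammaOut J A C w) := by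
  ext u
  have hR := isResolventAt_iff.1 (isResolventAt_resolventRel hz.1)
  have h := Γ.sub_mem (gammaOut_mem hJ hΓ hS hz u) (gammaOut_mem hJ hΓ hS hw u)
  simp only [Prod.mk_sub_mk, sub_self] at h
  have h2 := (mem_ext₂ Γ _ _).2 ⟨_, h⟩
  have h3 := (hR (gammaOut J A C z u - gammaOut J A C w u) ((z - w) • gammaOut J A C w u)).1 (by
    convert h2 using 2
    module)
  rw [add_apply, smul_apply, ContinuousLinearMap.comp_apply, ← map_smul, ← h3]
  abel

/-- The behaviour of `γ₂^#` at the origin. -/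
theorem tendsto_inv_smul_pontAdjoint_gammaOut (h0 : (0 : ℂ) ∈ innerDomain Γ) :
    Tendsto (fun z : ℂ => z⁻¹ • pontAdjoint J (gammaOut J A C (conj z)⁻¹)) (𝓝[≠] 0)
      (𝓝 (pontAdjoint J (gammaDual J A C 0))) := by
  have hcont : ContinuousAt (fun z => pontAdjoint J (gammaDual J A C z)) 0 := by
    have h1 := isUnit_pencil_adjoint hJ hΓ hS h0
    have h2 : ContinuousAt (gammaDual J A C) 0 :=
      ((differentiableAt_inverse_pencil h1).continuousAt.comp (f := fun z : ℂ => conj z)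
        (RCLike.continuous_conj (K := ℂ)).continuousAt).clm_comp continuousAt_const
    exact ((LinearIsometryEquiv.continuous _).continuousAt.comp h2).clm_comp continuousAt_const
  refine (hcont.tendsto.mono_left nhdsWithin_le_nhds).congr' ?_
  filter_upwards [self_mem_nhdsWithin] with z hz
  have hz0 : z ≠ 0 := hz
  -- The adjoint is antilinear, so the factor `z̄` in `gammaOut` becomes `z` and cancels `z⁻¹`; what
  -- remains is continuous at `0`.
  rw [gammaOut_inv_conj, pontAdjoint, pontAdjoint, map_smulₛₗ, Complex.conj_conj,
    ContinuousLinearMap.smul_comp, smul_smul, inv_mul_cancel₀ hz0, one_smul]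

theorem tendsto_pontAdjoint_gammaOut (h0 : (0 : ℂ) ∈ innerDomain Γ) :
    Tendsto (fun z : ℂ => pontAdjoint J (gammaOut J A C (conj z)⁻¹)) (𝓝[≠] 0) (𝓝 0) := by
  have h1 : Tendsto (fun z : ℂ => z) (𝓝[≠] 0) (𝓝 0) := nhdsWithin_le_nhds
  have h2 := h1.smul (tendsto_inv_smul_pontAdjoint_gammaOut hJ hΓ hS h0)
  rw [zero_smul] at h2
  refine h2.congr' ?_
  filter_upwards [self_mem_nhdsWithin] with z hz
  rw [smul_smul, mul_inv_cancel₀ (show z ≠ 0 from hz), one_smul]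

/-- The kernel of the Weyl function is the Gram kernel of the dual γ-field. -/
theorem inner_schurKernel_transferFun {z w : ℂ} (hz : z ∈ innerDomain Γ) (hw : w ∈ innerDomain Γ)
    (u v : L₂) :
    inner ℂ v (schurKernel (transferFun J A B C D) w z u) =
      indef J (gammaDual J A C w u) (gammaDual J A C z v) := by
  have h := hΓ.indef_sub (gammaDual_mem hJ hΓ hS hw u) (gammaDual_mem hJ hΓ hS hz v)
  have hne : 1 - z * conj w ≠ 0 := by
    intro h0
    have h1 : z * conj w = 1 := by linear_combination -h0
    have h2 : ‖z‖ * ‖w‖ = 1 := by rw [← RCLike.norm_conj w, ← norm_mul, h1, norm_one]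
    have hz1 : ‖z‖ < 1 := hz.2
    have hw1 : ‖w‖ < 1 := hw.2
    nlinarith [norm_nonneg z, norm_nonneg w]
  simp only [indef, map_smul, inner_smul_left, inner_smul_right,
    ContinuousLinearMap.adjoint_inner_left, Complex.conj_conj] at h
  simp only [schurKernel, indef, smul_apply, sub_apply, one_apply_eq_self,
    ContinuousLinearMap.comp_apply, inner_smul_right, inner_sub_right]
  rw [inv_mul_eq_iff_eq_mul₀ hne]
  linear_combination h

end IsScatteringBlock

end GammaFields

/-! ### Negative eigenvalues and negative subspaces -/

section NegativeEigenvalues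

open Matrix in
theorem dotProduct_mulVec_eq_sum_eigenvalues {n : ℕ} {M : Matrix (Fin n) (Fin n) ℂ}
    (hM : M.IsHermitian) (c : EuclideanSpace ℂ (Fin n)) :
    star c.ofLp ⬝ᵥ (M *ᵥ c.ofLp) =
      ((∑ i, hM.eigenvalues i * ‖hM.eigenvectorBasis.repr c i‖ ^ 2 : ℝ) : ℂ) := by
  have hsym := Matrix.isSymmetric_toEuclideanLin_iff.2 hM
  have h1 : star c.ofLp ⬝ᵥ (M *ᵥ c.ofLp) = inner ℂ c (Matrix.toEuclideanLin M c) := by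
    rw [EuclideanSpace.inner_eq_star_dotProduct, dotProduct_comm]
    rfl
  have h2 : ∀ i, Matrix.toEuclideanLin M (hM.eigenvectorBasis i) =
      (hM.eigenvalues i : ℂ) • hM.eigenvectorBasis i := by
    intro i
    apply (WithLp.ofLp_injective 2)
    exact (hM.mulVec_eigenvectorBasis i)
  rw [h1, ← hM.eigenvectorBasis.sum_inner_mul_inner]
  push_cast
  refine Finset.sum_congr rfl fun i _ => ?_
  rw [← hsym, h2, inner_smul_left, hM.eigenvectorBasis.repr_apply_apply, Complex.conj_ofReal,
    ← inner_conj_symm c, mul_left_comm, RCLike.conj_mul]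
  rfl

-- The span of the eigenvectors with negative eigenvalues is the extremal test space: `S` ranges
-- over it, and there the form is strictly negative off `0`.
open Matrix in
theorem negEigCount_le_of_forall {n : ℕ} {M : Matrix (Fin n) (Fin n) ℂ} (hM : M.IsHermitian)
    (k : ℕ)
    (h : ∀ (E : Type) [AddCommGroup E] [Module ℂ E] [FiniteDimensional ℂ E]
      (S : E →ₗ[ℂ] (Fin n → ℂ)), k < Module.finrank ℂ E →
        ∃ d, d ≠ 0 ∧ 0 ≤ (star (S d) ⬝ᵥ (M *ᵥ S d)).re) : negEigCount hM ≤ k := by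
  classical
  by_contra! hlt
  let ι := {i : Fin n // hM.eigenvalues i < 0}
  let ext : (ι → ℂ) →ₗ[ℂ] (Fin n → ℂ) :=
    { toFun := fun d i => if hi : hM.eigenvalues i < 0 then d ⟨i, hi⟩ else 0
      map_add' := fun d e => by ext i; by_cases hi : hM.eigenvalues i < 0 <;> simp [hi]
      map_smul' := fun a d => by ext i; by_cases hi : hM.eigenvalues i < 0 <;> simp [hi] }
  let S : (ι → ℂ) →ₗ[ℂ] (Fin n → ℂ) :=
    (WithLp.linearEquiv 2 ℂ (Fin n → ℂ)).toLinearMap ∘ₗ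
      hM.eigenvectorBasis.repr.symm.toLinearEquiv.toLinearMap ∘ₗ
        (WithLp.linearEquiv 2 ℂ (Fin n → ℂ)).symm.toLinearMap ∘ₗ ext
  obtain ⟨d, hd0, hd⟩ := h (ι → ℂ) S (by
    rw [Module.finrank_fintype_fun_eq_card, ← Nat.card_eq_fintype_card]; exact hlt)
  have hS : S d = (hM.eigenvectorBasis.repr.symm (WithLp.toLp 2 (ext d))).ofLp := rfl
  rw [hS, dotProduct_mulVec_eq_sum_eigenvalues hM, LinearIsometryEquiv.apply_symm_apply,
    Complex.ofReal_re] at hd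
  refine absurd hd (not_le.2 ?_)
  obtain ⟨j, hj⟩ := Function.ne_iff.1 hd0
  have hext : ∀ i (hi : hM.eigenvalues i < 0), ext d i = d ⟨i, hi⟩ := fun i hi => by simp [ext, hi]
  have hext' : ∀ i, ¬ hM.eigenvalues i < 0 → ext d i = 0 := fun i hi => by simp [ext, hi]
  refine Finset.sum_neg' (fun i _ => ?_) ⟨j, Finset.mem_univ _, ?_⟩
  · by_cases hi : hM.eigenvalues i < 0
    · exact mul_nonpos_of_nonpos_of_nonneg hi.le (sq_nonneg _)
    · simp [hext' i hi]
  · refine mul_neg_of_neg_of_pos j.2 ?_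
    have : ext d j ≠ 0 := by rw [hext j j.2]; exact hj
    have h2 : 0 < ‖ext d j‖ := norm_pos_iff.2 this
    change 0 < ‖ext d j‖ ^ 2
    positivity

-- If `E` had larger dimension, some nonzero `d` would have no component along the negative
-- eigenvectors, and the form at `S d` would be nonnegative.
open Matrix in
theorem finrank_le_negEigCount {n : ℕ} {M : Matrix (Fin n) (Fin n) ℂ} (hM : M.IsHermitian)
    {E : Type*} [AddCommGroup E] [Module ℂ E] [FiniteDimensional ℂ E]
    (S : E →ₗ[ℂ] (Fin n → ℂ))
    (h : ∀ d, d ≠ 0 → (star (S d) ⬝ᵥ (M *ᵥ S d)).re < 0) :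
    Module.finrank ℂ E ≤ negEigCount hM := by
  classical
  by_contra! hlt
  let ι := {i : Fin n // hM.eigenvalues i < 0}
  let R : E →ₗ[ℂ] (ι → ℂ) :=
    LinearMap.funLeft ℂ ℂ (Subtype.val : ι → Fin n) ∘ₗ
      (WithLp.linearEquiv 2 ℂ (Fin n → ℂ)).toLinearMap ∘ₗ
        hM.eigenvectorBasis.repr.toLinearEquiv.toLinearMap ∘ₗ
          (WithLp.linearEquiv 2 ℂ (Fin n → ℂ)).symm.toLinearMap ∘ₗ S
  have hR : LinearMap.ker R ≠ ⊥ := R.ker_ne_bot_of_finrank_lt (by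
    rw [Module.finrank_fintype_fun_eq_card, ← Nat.card_eq_fintype_card]; exact hlt)
  obtain ⟨d, hd, hd0⟩ := (Submodule.ne_bot_iff _).1 hR
  have hd' : ∀ i : ι, hM.eigenvectorBasis.repr (WithLp.toLp 2 (S d)) i = 0 :=
    fun i => congrFun (LinearMap.mem_ker.1 hd) i
  have := h d hd0
  rw [show S d = (WithLp.toLp 2 (S d)).ofLp from rfl, dotProduct_mulVec_eq_sum_eigenvalues hM,
    Complex.ofReal_re] at this
  refine absurd this (not_lt.2 (Finset.sum_nonneg fun i _ => ?_))
  by_cases hi : hM.eigenvalues i < 0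
  · rw [hd' ⟨i, hi⟩]; simp
  · exact mul_nonneg (not_lt.1 hi) (sq_nonneg _)

end NegativeEigenvalues

/-! ### Negative squares of the Weyl function -/

section SchurClass

variable {H L₁ L₂ : Type*}
  [NormedAddCommGroup H] [InnerProductSpace ℂ H] [CompleteSpace H]
  [NormedAddCommGroup L₁] [InnerProductSpace ℂ L₁] [CompleteSpace L₁]
  [NormedAddCommGroup L₂] [InnerProductSpace ℂ L₂] [CompleteSpace L₂]
  {J : H →L[ℂ] H} {κ : ℕ} {V : Submodule ℂ (H × H)} {Γ : Submodule ℂ ((H × H) × (L₁ × L₂))}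
  {A : H →L[ℂ] H} {B : L₁ →L[ℂ] H} {C : H →L[ℂ] L₂} {D : L₁ →L[ℂ] L₂}

theorem exists_hasNegSquares_of_bounded {Θ : ℂ → L₁ →L[ℂ] L₂} {Ω : Set ℂ} {k : ℕ}
    (h : ∀ (n : ℕ) (ω : Fin n → ℂ) (f : Fin n → L₂), (∀ i, ω i ∈ Ω) →
      negEigCount (schurGram_isHermitian Θ ω f) ≤ k) : ∃ k' ≤ k, HasNegSquares k' Θ Ω := by
  classical
  let P : ℕ → Prop := fun m => ∃ (n : ℕ) (ω : Fin n → ℂ) (f : Fin n → L₂), (∀ i, ω i ∈ Ω) ∧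
    negEigCount (schurGram_isHermitian Θ ω f) = m
  -- The empty family attains some value, so the greatest attained value exists.
  have hP : ∃ m ≤ k, P m :=
    ⟨_, h 0 Fin.elim0 Fin.elim0 (fun i => i.elim0), 0, Fin.elim0, Fin.elim0, fun i => i.elim0, rfl⟩
  obtain ⟨m, hm, hPm⟩ := hP
  refine ⟨Nat.findGreatest P k, Nat.findGreatest_le k, fun n ω f hω => ?_,
    Nat.findGreatest_spec hm hPm⟩
  exact Nat.le_findGreatest (h n ω f hω) ⟨n, ω, f, hω, rfl⟩

namespace IsScatteringBlock

variable (hJ : IsPontryaginSymmetry J κ) (hΓ : IsUnitaryBoundaryPair J V Γ)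
  (hS : IsScatteringBlock J Γ A B C D)
include hJ hΓ hS

open Matrix in
theorem dotProduct_schurGram {n : ℕ} {ω : Fin n → ℂ} (f : Fin n → L₂)
    (hω : ∀ i, ω i ∈ innerDomain Γ) (c : Fin n → ℂ) :
    star c ⬝ᵥ (schurGram (transferFun J A B C D) ω f *ᵥ c) =
      indef J (∑ i, c i • gammaDual J A C (ω i) (f i))
        (∑ i, c i • gammaDual J A C (ω i) (f i)) := by
  simp only [dotProduct, mulVec, schurGram, Matrix.of_apply,
    inner_schurKernel_transferFun hJ hΓ hS (hω _) (hω _), indef, map_sum, map_smul, sum_inner,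
    inner_sum, inner_smul_left, inner_smul_right, Pi.star_apply, RCLike.star_def]
  simp only [Finset.mul_sum]
  rw [Finset.sum_comm]
  refine Finset.sum_congr rfl fun i _ => Finset.sum_congr rfl fun j _ => ?_
  ring

/-- The matrix form is the indefinite square of a combination of vectors in `H`; in more than `κ`
parameters some nonzero choice kills the negative part. -/
theorem negEigCount_schurGram_le {n : ℕ} {ω : Fin n → ℂ} (f : Fin n → L₂)
    (hω : ∀ i, ω i ∈ innerDomain Γ) :
    negEigCount (schurGram_isHermitian (transferFun J A B C D) ω f) ≤ κ := by
  refine negEigCount_le_of_forall _ κ fun E _ _ _ S hE => ?_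
  obtain ⟨d, hd0, hd⟩ := hJ.exists_ne_zero_negProj_eq_zero
    (Fintype.linearCombination ℂ (fun i => gammaDual J A C (ω i) (f i)) ∘ₗ S) hE
  refine ⟨d, hd0, ?_⟩
  rw [LinearMap.comp_apply, Fintype.linearCombination_apply] at hd
  rw [dotProduct_schurGram hJ hΓ hS f hω, hJ.re_indef_self, hd, norm_zero]
  nlinarith [sq_nonneg ‖posProj J (∑ i, S d i • gammaDual J A C (ω i) (f i))‖]

theorem isGenSchur_of_hasNegSquares {k : ℕ}
    (h : HasNegSquares k (transferFun J A B C D) (innerDomain Γ)) :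
    IsGenSchur k (transferFun J A B C D) (innerDomain Γ) where
  isOpen := isOpen_innerDomain hJ hΓ hS
  subset_disk := fun _ hz => hz.2
  holomorphic := fun _ hz => (differentiableAt_transferFun B C D
    ((mem_innerDomain_iff hJ hΓ hS).1 hz).2).differentiableWithinAt
  negSquares := h

/-- A negative subspace of dimension `κ` in the span of the dual γ-field yields `κ` negative
squares. -/
theorem hasNegSquares_of_negative_span (x : Fin κ → H)
    (hx : ∀ i, x i ∈ ⨆ z ∈ innerDomain Γ, LinearMap.range (gammaDual J A C z : L₂ →ₗ[ℂ] H))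
    (hneg : ∀ c : Fin κ → ℂ, c ≠ 0 → (indef J (∑ i, c i • x i) (∑ i, c i • x i)).re < 0) :
    HasNegSquares κ (transferFun J A B C D) (innerDomain Γ) := by
  refine ⟨fun n ω f hω => negEigCount_schurGram_le hJ hΓ hS f hω, ?_⟩
  let v : innerDomain Γ × L₂ → H := fun p => gammaDual J A C p.1 p.2
  have hspan : (⨆ z ∈ innerDomain Γ, LinearMap.range (gammaDual J A C z : L₂ →ₗ[ℂ] H)) ≤
      Submodule.span ℂ (Set.range v) := by
    refine iSup₂_le fun z hz => ?_
    rintro _ ⟨u, rfl⟩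
    exact Submodule.subset_span ⟨(⟨z, hz⟩, u), rfl⟩
  have hx' : ∀ i, ∃ a : (innerDomain Γ × L₂) →₀ ℂ, Finsupp.linearCombination ℂ v a = x i :=
    fun i => Finsupp.mem_span_range_iff_exists_finsupp.1 (hspan (hx i))
  choose a ha using hx'
  classical
  -- One common list of points and vectors representing all the `x i`; `S` converts coefficients of
  -- the `x i` into coefficients on this list.
  let s : Finset (innerDomain Γ × L₂) := Finset.univ.biUnion fun i => (a i).support
  let e := s.equivFin
  let p : Fin s.card → innerDomain Γ × L₂ := fun j => (e.symm j : innerDomain Γ × L₂)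
  let S : (Fin κ → ℂ) →ₗ[ℂ] (Fin s.card → ℂ) :=
    Fintype.linearCombination ℂ fun i j => a i (p j)
  have hsum : ∀ i, ∑ j, a i (p j) • v (p j) = x i := by
    intro i
    rw [← ha i, Finsupp.linearCombination_apply,
      Finsupp.sum_of_support_subset (a i) (s := s) (Finset.subset_biUnion_of_mem
        (fun i => (a i).support) (Finset.mem_univ i)) (fun q r => r • v q)
        (fun _ _ => zero_smul _ _),
      ← Finset.sum_coe_sort s (fun q => a i q • v q)]
    exact Equiv.sum_comp e.symm (fun q : s => a i q • v q)
  have hS' : ∀ c, ∑ j, S c j • v (p j) = ∑ i, c i • x i := by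
    intro c
    simp only [S, Fintype.linearCombination_apply, Finset.sum_apply, Pi.smul_apply,
      Finset.sum_smul, ← hsum, Finset.smul_sum]
    rw [Finset.sum_comm]
    exact Finset.sum_congr rfl fun i _ => Finset.sum_congr rfl fun j _ => by
      rw [smul_assoc]
  have hω : ∀ j, ((p j).1 : ℂ) ∈ innerDomain Γ := fun j => (p j).1.2
  refine ⟨s.card, fun j => (p j).1, fun j => (p j).2, hω, le_antisymm
    (negEigCount_schurGram_le hJ hΓ hS _ hω) ?_⟩
  have hle := finrank_le_negEigCount
    (schurGram_isHermitian (transferFun J A B C D) (fun j => ((p j).1 : ℂ)) fun j => (p j).2) S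
    fun c hc => by
      rw [dotProduct_schurGram hJ hΓ hS _ hω]
      have := hS' c
      simp only [v] at this
      rw [this]
      exact hneg c hc
  simpa using hle

end IsScatteringBlock

end SchurClass

/-! ### Weak compactness and weak closedness -/

section WeakLimits

variable {H : Type*} [NormedAddCommGroup H] [InnerProductSpace ℂ H]

/-- Bounded sequences in a Hilbert space have weak limits along ultrafilters. -/
theorem exists_weak_limit [CompleteSpace H] (𝒰 : Ultrafilter ℕ) (e : ℕ → H) (he : ∀ n, ‖e n‖ ≤ 1) :
    ∃ e₀ : H, ∀ v, Tendsto (fun n => (inner ℂ v (e n) : ℂ)) 𝒰 (𝓝 (inner ℂ v e₀)) := by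
  let φ : ℕ → WeakDual ℂ H := fun n =>
    StrongDual.toWeakDual (InnerProductSpace.toDual ℂ H (e n))
  have hmem : ∀ n, φ n ∈ WeakDual.toStrongDual ⁻¹' Metric.closedBall (0 : StrongDual ℂ H) 1 := by
    intro n
    simpa [φ] using he n
  obtain ⟨ψ, -, hψ⟩ := (WeakDual.isCompact_closedBall (0 : StrongDual ℂ H) 1).ultrafilter_le_nhds
    (𝒰.map φ) (tendsto_principal.2 (Filter.Eventually.of_forall hmem))
  have hψ' : Tendsto φ 𝒰 (𝓝 ψ) := hψ
  refine ⟨(InnerProductSpace.toDual ℂ H).symm (WeakDual.toStrongDual ψ), fun v => ?_⟩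
  have h1 : Tendsto (fun n => φ n v) 𝒰 (𝓝 (ψ v)) :=
    ((WeakDual.eval_continuous v).tendsto ψ).comp hψ'
  have h2 : ψ v = inner ℂ ((InnerProductSpace.toDual ℂ H).symm (WeakDual.toStrongDual ψ)) v := by
    rw [InnerProductSpace.toDual_symm_apply]; rfl
  rw [h2] at h1
  -- The Riesz map puts `e n` in the antilinear slot; conjugation moves it to the linear one.
  have h3 := (RCLike.continuous_conj (K := ℂ)).tendsto _ |>.comp h1
  rw [inner_conj_symm] at h3
  refine h3.congr fun n => ?_
  change conj (inner ℂ (e n) v) = _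
  rw [inner_conj_symm]

/-- Hahn–Banach: a functional separating `x` from `S` is bounded above on a subspace, hence vanishes
there. It lets weak limits of elements of a closed relation stay in the relation. -/
theorem mem_of_forall_dual {E : Type*} [NormedAddCommGroup E] [NormedSpace ℂ E]
    (S : Submodule ℂ E) (hS : IsClosed (S : Set E)) (x : E)
    (h : ∀ φ : StrongDual ℂ E, (∀ y ∈ S, φ y = 0) → φ x = 0) : x ∈ S := by
  by_contra hx
  obtain ⟨φ, u, hu, hux⟩ := RCLike.geometric_hahn_banach_closed_point (𝕜 := ℂ)
    (s := (S : Set E)) (S.restrictScalars ℝ).convex hS hx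
  have hu0 : 0 < u := by simpa using hu 0 S.zero_mem
  have hre : ∀ y ∈ S, (φ y).re ≤ 0 := by
    intro y hy
    by_contra! hpos
    have := hu (((u / (φ y).re : ℝ) : ℂ) • y) (S.smul_mem _ hy)
    rw [map_smul, smul_eq_mul] at this
    change (((u / (φ y).re : ℝ) : ℂ) * φ y).re < u at this
    rw [Complex.re_ofReal_mul, div_mul_cancel₀ _ hpos.ne'] at this
    exact lt_irrefl _ this
  have hzero : ∀ y ∈ S, φ y = 0 := by
    intro y hy
    have h1 := hre _ (S.smul_mem (conj (φ y)) hy)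
    rw [map_smul, smul_eq_mul, mul_comm, Complex.mul_conj, Complex.ofReal_re] at h1
    exact Complex.normSq_eq_zero.1 (le_antisymm h1 (Complex.normSq_nonneg _))
  have := h φ hzero
  rw [this] at hux
  simp at hux
  linarith

end WeakLimits

/-! ### Approximate eigenvectors and lower bounds for `V - z` -/

section Eigenvectors

variable {H : Type*} [NormedAddCommGroup H] [InnerProductSpace ℂ H] [CompleteSpace H]
  {J : H →L[ℂ] H} {κ : ℕ} {V : Submodule ℂ (H × H)}

theorem IsPontryaginSymmetry.norm_indef_le (hJ : IsPontryaginSymmetry J κ) (f g : H) :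
    ‖indef J f g‖ ≤ ‖f‖ * ‖g‖ := by
  have hnorm : ‖J f‖ = ‖f‖ := by
    have h : inner ℂ (J f) (J f) = inner ℂ f f := by rw [hJ.inner_J_left, hJ.apply_apply]
    rw [inner_self_eq_norm_sq_to_K, inner_self_eq_norm_sq_to_K] at h
    have h' : ‖J f‖ ^ 2 = ‖f‖ ^ 2 := by exact_mod_cast h
    exact (sq_eq_sq₀ (norm_nonneg _) (norm_nonneg _)).1 h'
  calc ‖indef J f g‖ ≤ ‖g‖ * ‖J f‖ := norm_inner_le_norm _ _
    _ = ‖f‖ * ‖g‖ := by rw [hnorm, mul_comm]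

/-- Only `|z| = 1` is left to exclude. For `g` in the defect subspace at `w` one gets `[g, e] = z̄ w
[g, e]`, and `|z̄ w| ≠ 1` forces `[g, e] = 0`; the defect subspaces are total. -/
theorem IsSimpleIsometric.eq_zero_of_mem (hJ : IsPontryaginSymmetry J κ)
    (hV : IsSimpleIsometric J V) {z : ℂ} {e : H} (he : (e, z • e) ∈ V) : e = 0 := by
  by_contra hne
  have hz : ‖z‖ = 1 := hV.1 z ⟨e, hne, he⟩
  have hle : (⨆ w ∈ {w : ℂ | ‖w‖ ≠ 1}, defectSubspace J V w) ≤ (ℂ ∙ J e)ᗮ := by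
    refine iSup₂_le fun w hw g hg => ?_
    have h1 : indef J g e = indef J (w • g) (z • e) := hg (e, z • e) he
    rw [Submodule.mem_orthogonal_singleton_iff_inner_right, hJ.inner_J_left]
    change indef J g e = 0
    have h2 : indef J (w • g) (z • e) = conj z * w * indef J g e := by
      simp only [indef, map_smul, inner_smul_left, inner_smul_right]; ring
    rw [h2] at h1
    by_contra hne'
    have h3 : conj z * w = 1 := mul_right_cancel₀ hne' (by rw [one_mul, ← h1])
    have h4 := congrArg norm h3
    rw [norm_mul, RCLike.norm_conj, hz, one_mul, norm_one] at h4
    exact hw h4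
  have htop := hV.2
  rw [Submodule.topologicalClosure_eq_top_iff] at htop
  have h5 : J e ∈ (⨆ w ∈ {w : ℂ | ‖w‖ ≠ 1}, defectSubspace J V w)ᗮ :=
    Submodule.orthogonal_le hle
      (Submodule.le_orthogonal_orthogonal _ (Submodule.mem_span_singleton_self _))
  rw [htop, Submodule.mem_bot] at h5
  apply hne
  rw [← hJ.apply_apply e, h5, map_zero]

/-- `negProj J` has finite rank, so it turns weak convergence into norm convergence. -/
theorem IsPontryaginSymmetry.tendsto_negProj_zero (hJ : IsPontryaginSymmetry J κ)
    {l : Filter ℕ} {e : ℕ → H} (he : ∀ v, Tendsto (fun n => (inner ℂ v (e n) : ℂ)) l (𝓝 0)) :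
    Tendsto (fun n => ‖negProj J (e n)‖ ^ 2) l (𝓝 0) := by
  have := hJ.finite_neg
  let N := LinearMap.ker ((J + 1 : H →L[ℂ] H) : H →ₗ[ℂ] H)
  let b := stdOrthonormalBasis ℂ N
  have hsum : ∀ f, ‖negProj J f‖ ^ 2 = ∑ i, ‖inner ℂ (b i : H) f‖ ^ 2 := by
    intro f
    have h := b.sum_sq_norm_inner_right ⟨negProj J f, hJ.negProj_mem f⟩
    rw [← Submodule.norm_coe] at h
    refine h.symm.trans (Finset.sum_congr rfl fun i _ => ?_)
    rw [Submodule.coe_inner]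
    simp only
    rw [← hJ.inner_negProj_left, (negProj_eq_self_iff _).2 (b i).2]
  simp only [hsum]
  have h0 : Tendsto (fun n => ∑ i, ‖(inner ℂ (b i : H) (e n) : ℂ)‖ ^ 2) l
      (𝓝 (∑ _i : Fin (Module.finrank ℂ N), ‖(0 : ℂ)‖ ^ 2)) :=
    tendsto_finsetSum _ fun i _ => ((he (b i)).norm).pow 2
  simpa using h0

/-- Approximate eigenvectors with a substantial negative part accumulate weakly at an
eigenvector. -/
theorem IsPontryaginSymmetry.exists_eigenvector (hJ : IsPontryaginSymmetry J κ)
    (hV : IsClosed (V : Set (H × H))) {f g : ℕ → H} {z : ℕ → ℂ}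
    (hmem : ∀ n, (f n, g n + z n • f n) ∈ V) (hz : ∀ n, ‖z n‖ ≤ 1) (hf : ∀ n, f n ≠ 0)
    (hg : Tendsto (fun n => ‖g n‖ / ‖f n‖) atTop (𝓝 0))
    (hneg : ∀ n, ‖f n‖ ^ 2 ≤ 4 * ‖negProj J (f n)‖ ^ 2) :
    ∃ z₀ : ℂ, ∃ e : H, e ≠ 0 ∧ (e, z₀ • e) ∈ V := by
  let 𝒰 : Ultrafilter ℕ := hyperfilter ℕ
  have h𝒰 : (𝒰 : Filter ℕ) ≤ atTop := Nat.hyperfilter_le_atTop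
  let c : ℕ → ℂ := fun n => ((‖f n‖⁻¹ : ℝ) : ℂ)
  have hfpos : ∀ n, 0 < ‖f n‖ := fun n => norm_pos_iff.2 (hf n)
  have hc : ∀ n, ‖c n‖ = ‖f n‖⁻¹ := fun n => by
    rw [Complex.norm_real, norm_inv, norm_norm]
  have he1 : ∀ n, ‖c n • f n‖ = 1 := fun n => by
    rw [norm_smul, hc, inv_mul_cancel₀ (hfpos n).ne']
  have hx0 : Tendsto (fun n => c n • g n) 𝒰 (𝓝 0) := by
    rw [tendsto_zero_iff_norm_tendsto_zero]
    refine (hg.mono_left h𝒰).congr fun n => ?_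
    rw [norm_smul, hc, div_eq_inv_mul]
  obtain ⟨e, he⟩ := exists_weak_limit 𝒰 (fun n => c n • f n) fun n => (he1 n).le
  obtain ⟨z₀, -, hz₀⟩ := (isCompact_closedBall (0 : ℂ) 1).ultrafilter_le_nhds (𝒰.map z)
    (tendsto_principal.2 (Filter.Eventually.of_forall fun n => by simpa using hz n))
  have hz₀' : Tendsto z 𝒰 (𝓝 z₀) := hz₀
  refine ⟨z₀, e, ?_, ?_⟩
  -- A zero weak limit would make the negative parts of the unit vectors tend to `0`, against the
  -- lower bound `1/4` on their squares.
  · rintro rfl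
    have h1 := hJ.tendsto_negProj_zero (l := 𝒰) (e := fun n => c n • f n)
      (by simpa using he)
    have h2 : (1 / 4 : ℝ) ≤ 0 := by
      refine ge_of_tendsto h1 (Filter.Eventually.of_forall fun n => ?_)
      rw [map_smul, norm_smul, hc, mul_pow, inv_pow, ← div_eq_inv_mul,
        le_div_iff₀ (pow_pos (hfpos n) 2)]
      linarith [hneg n]
    norm_num at h2
  · refine mem_of_forall_dual V hV _ fun φ hφ => ?_
    have hdual : ∀ ψ : StrongDual ℂ H, Tendsto (fun n => ψ (c n • f n)) 𝒰 (𝓝 (ψ e)) := by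
      intro ψ
      have := he ((InnerProductSpace.toDual ℂ H).symm ψ)
      simpa only [InnerProductSpace.toDual_symm_apply] using this
    have h1 := hdual (φ ∘L ContinuousLinearMap.inl ℂ H H)
    have h2 := hdual (φ ∘L ContinuousLinearMap.inr ℂ H H)
    have h3 := ((φ ∘L ContinuousLinearMap.inr ℂ H H).continuous.tendsto 0).comp hx0
    rw [map_zero] at h3
    have h4 := (h1.add h3).add (hz₀'.smul h2)
    have h5 : ∀ n, (φ ∘L ContinuousLinearMap.inl ℂ H H) (c n • f n) +
        (φ ∘L ContinuousLinearMap.inr ℂ H H) (c n • g n) +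
        z n • (φ ∘L ContinuousLinearMap.inr ℂ H H) (c n • f n) = 0 := by
      intro n
      have hm := hφ _ (V.smul_mem (c n) (hmem n))
      rw [← map_smul]
      simp only [ContinuousLinearMap.comp_apply, ← map_add]
      rw [← hm]
      congr 1
      simp only [ContinuousLinearMap.inl_apply, ContinuousLinearMap.inr_apply, Prod.mk_add_mk,
        add_zero, zero_add, Prod.smul_mk, smul_add]
      rw [smul_comm]
    have h6 := tendsto_nhds_unique (h4.congr h5) tendsto_const_nhds
    rw [add_zero, ← map_smul] at h6
    simp only [ContinuousLinearMap.comp_apply, ← map_add] at h6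
    simpa using h6

theorem IsClosedIsometricOperator.re_indef_eq (hJ : IsPontryaginSymmetry J κ)
    (hV : IsClosedIsometricOperator J V) {f g : H} {z : ℂ} (h : (f, g + z • f) ∈ V) :
    (1 - ‖z‖ ^ 2) * (indef J f f).re = (indef J g g).re + 2 * (z * indef J f g).re := by
  have h1 := hV.isometric _ _ h
  have h2 : indef J (g + z • f) (g + z • f) =
      indef J g g + z * indef J f g + conj (z * indef J f g) +
        ((‖z‖ ^ 2 : ℝ) : ℂ) * indef J f f := by
    have hzz : ((‖z‖ ^ 2 : ℝ) : ℂ) = conj z * z := by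
      rw [RCLike.conj_mul]; norm_cast
    rw [map_mul, hJ.indef_conj, hzz]
    simp only [indef, map_add, map_smul, inner_add_left, inner_add_right, inner_smul_left,
      inner_smul_right]
    ring
  rw [h2] at h1
  have h3 := congrArg Complex.re h1
  rw [Complex.add_re, Complex.add_re, Complex.add_re, Complex.conj_re, Complex.re_ofReal_mul] at h3
  linarith

/-- An isometric operator without eigenvectors is bounded below, locally uniformly in the disk. -/
theorem IsClosedIsometricOperator.exists_bound (hJ : IsPontryaginSymmetry J κ)
    (hV : IsClosedIsometricOperator J V) (hev : ∀ (z : ℂ) (e : H), (e, z • e) ∈ V → e = 0)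
    {r : ℝ} (hr0 : 0 ≤ r) (hr : r < 1) :
    ∃ K, 0 ≤ K ∧ ∀ (z : ℂ) (f g : H), ‖z‖ ≤ r → (f, g + z • f) ∈ V → ‖f‖ ≤ K * ‖g‖ := by
  by_contra! hcon
  have hpos : 0 < 1 - r ^ 2 := by nlinarith
  -- The offset makes `3 ‖f‖ ‖g‖ ≤ (1 - r²) ‖f‖² / 2` from the start of the sequence, whence `[f, f]
  -- ≤ ‖f‖² / 2`, which is `‖f‖² ≤ 4 ‖P₋ f‖²`.
  obtain ⟨N, hN⟩ := exists_nat_ge (6 / (1 - r ^ 2))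
  have hN6 : 6 ≤ (N : ℝ) * (1 - r ^ 2) := by rwa [div_le_iff₀ hpos] at hN
  have hN1 : (1 : ℝ) ≤ N := by nlinarith [sq_nonneg r]
  choose z f g hz hmem hlt using fun n : ℕ => hcon (n + N) (by positivity)
  have hf : ∀ n, 0 < ‖f n‖ := fun n =>
    (mul_nonneg (by positivity) (norm_nonneg _)).trans_lt (hlt n)
  have hg : ∀ n, N * ‖g n‖ ≤ ‖f n‖ := fun n =>
    (mul_le_mul_of_nonneg_right (by simp) (norm_nonneg _)).trans (hlt n).le
  obtain ⟨z₀, e, he, heV⟩ := hJ.exists_eigenvector hV.closed hmem (fun n => (hz n).trans hr.le)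
    (fun n => norm_pos_iff.1 (hf n)) (by
      refine squeeze_zero (fun n => by positivity) (fun n => ?_)
        tendsto_one_div_add_atTop_nhds_zero_nat
      rw [div_le_div_iff₀ (hf n) (by positivity), one_mul, mul_comm]
      refine le_trans (mul_le_mul_of_nonneg_right ?_ (norm_nonneg _)) (hlt n).le
      linarith) (fun n => by
      have h1 := hV.re_indef_eq hJ (hmem n)
      have h2 : (indef J (g n) (g n)).re ≤ ‖g n‖ * ‖g n‖ :=
        (Complex.re_le_norm _).trans (hJ.norm_indef_le _ _)
      have h3 : (z n * indef J (f n) (g n)).re ≤ ‖f n‖ * ‖g n‖ := by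
        refine (Complex.re_le_norm _).trans ?_
        rw [norm_mul]
        calc ‖z n‖ * ‖indef J (f n) (g n)‖ ≤ 1 * (‖f n‖ * ‖g n‖) :=
              mul_le_mul ((hz n).trans hr.le) (hJ.norm_indef_le _ _) (norm_nonneg _) zero_le_one
          _ = _ := one_mul _
      have h4 : ‖g n‖ ≤ ‖f n‖ := by nlinarith [hg n, norm_nonneg (g n)]
      have h5 : (1 - ‖z n‖ ^ 2) * (indef J (f n) (f n)).re ≤ 3 * (‖f n‖ * ‖g n‖) := by
        nlinarith [norm_nonneg (g n)]
      have h6 : 1 - r ^ 2 ≤ 1 - ‖z n‖ ^ 2 := by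
        have := pow_le_pow_left₀ (norm_nonneg _) (hz n) 2
        linarith
      have h7 : (indef J (f n) (f n)).re ≤ ‖f n‖ ^ 2 / 2 := by
        by_contra! h8
        have h9 : (1 - r ^ 2) * (‖f n‖ ^ 2 / 2) < 3 * (‖f n‖ * ‖g n‖) :=
          calc (1 - r ^ 2) * (‖f n‖ ^ 2 / 2) < (1 - r ^ 2) * (indef J (f n) (f n)).re :=
                mul_lt_mul_of_pos_left h8 hpos
            _ ≤ (1 - ‖z n‖ ^ 2) * (indef J (f n) (f n)).re :=
                mul_le_mul_of_nonneg_right h6 (le_trans (by positivity) h8.le)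
            _ ≤ _ := h5
        have h10 : (1 - r ^ 2) * ‖f n‖ < 6 * ‖g n‖ := by
          by_contra! h11
          nlinarith [hf n]
        have h11 : (1 - r ^ 2) * (N * ‖g n‖) ≤ (1 - r ^ 2) * ‖f n‖ :=
          mul_le_mul_of_nonneg_left (hg n) hpos.le
        nlinarith [norm_nonneg (g n)]
      have h8 := hJ.norm_sq_eq_add (f n)
      rw [hJ.re_indef_self] at h7
      linarith)
  exact he (hev z₀ e heV)

end Eigenvectors

/-! ### The intersection of the ranges of `V - z` -/

section RegularSubspace

variable {H : Type*} [NormedAddCommGroup H] [InnerProductSpace ℂ H]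

/-- The intersection of the ranges of `V - z I` over the unit disk. -/
def regularSubspace (V : Submodule ℂ (H × H)) : Submodule ℂ H where
  carrier := {x | ∀ z : ℂ, ‖z‖ < 1 → ∃ f, (f, x + z • f) ∈ V}
  zero_mem' := fun z _ => ⟨0, by rw [smul_zero, add_zero]; exact V.zero_mem⟩
  add_mem' := by
    intro x y hx hy z hz
    obtain ⟨f, hf⟩ := hx z hz
    obtain ⟨g, hg⟩ := hy z hz
    refine ⟨f + g, ?_⟩
    have h := V.add_mem hf hg
    rw [Prod.mk_add_mk] at h
    convert h using 2
    module
  smul_mem' := by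
    intro c x hx z hz
    obtain ⟨f, hf⟩ := hx z hz
    refine ⟨c • f, ?_⟩
    have h := V.smul_mem c hf
    rw [Prod.smul_mk] at h
    convert h using 2
    module

open Classical in
/-- The solution `f` of `(V - z I) f = x`, when it exists. -/
def resolventVec (V : Submodule ℂ (H × H)) (x : H) (z : ℂ) : H :=
  if h : ∃ f, (f, x + z • f) ∈ V then h.choose else 0

theorem resolventVec_mem {V : Submodule ℂ (H × H)} {x : H} (hx : x ∈ regularSubspace V) {z : ℂ}
    (hz : ‖z‖ < 1) : (resolventVec V x z, x + z • resolventVec V x z) ∈ V := by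
  have h := hx z hz
  rw [resolventVec, dif_pos h]
  exact h.choose_spec

/-- The resolvent identity at the level of relations: `(V - z)(f - g) = (z - w) g`. -/
theorem smul_mem_of_sub_mem {V : Submodule ℂ (H × H)} {x f g : H} {z w : ℂ}
    (hf : (f, x + z • f) ∈ V) (hg : (g, x + w • g) ∈ V) :
    (f - g, (z - w) • g + z • (f - g)) ∈ V := by
  have h := V.sub_mem hf hg
  rw [Prod.mk_sub_mk] at h
  convert h using 2
  module

theorem eq_resolventVec {V : Submodule ℂ (H × H)}
    (hev : ∀ (z : ℂ) (e : H), (e, z • e) ∈ V → e = 0) {x f : H} {z : ℂ}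
    (hf : (f, x + z • f) ∈ V) : f = resolventVec V x z := by
  have h : ∃ f, (f, x + z • f) ∈ V := ⟨f, hf⟩
  have h1 := smul_mem_of_sub_mem hf h.choose_spec
  rw [sub_self, zero_smul, zero_add] at h1
  rw [resolventVec, dif_pos h]
  exact sub_eq_zero.1 (hev z _ h1)

variable [CompleteSpace H] {J : H →L[ℂ] H} {κ : ℕ} {V : Submodule ℂ (H × H)}
  (hJ : IsPontryaginSymmetry J κ) (hV : IsClosedIsometricOperator J V)
  (hev : ∀ (z : ℂ) (e : H), (e, z • e) ∈ V → e = 0)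
include hJ hV hev

/-- Solutions of `(V - z I) f = x` are Lipschitz in `z`, locally uniformly in the disk. -/
theorem exists_lipschitz_bound {r : ℝ} (hr0 : 0 ≤ r) (hr : r < 1) (x : H) :
    ∃ K, 0 ≤ K ∧ ∀ (z w : ℂ) (f g : H), ‖z‖ ≤ r → ‖w‖ ≤ r → (f, x + z • f) ∈ V →
      (g, x + w • g) ∈ V → ‖f - g‖ ≤ K * ‖z - w‖ := by
  obtain ⟨K, hK0, hK⟩ := hV.exists_bound hJ hev hr0 hr
  refine ⟨K * (K * ‖x‖), by positivity, fun z w f g hz hw hf hg => ?_⟩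
  have h1 := hK z _ _ hz (smul_mem_of_sub_mem hf hg)
  have h2 := hK w _ _ hw hg
  rw [norm_smul] at h1
  calc ‖f - g‖ ≤ K * (‖z - w‖ * ‖g‖) := h1
    _ ≤ K * (‖z - w‖ * (K * ‖x‖)) := by gcongr
    _ = _ := by ring

/-- Exceptional points are limits of good ones; the Lipschitz bound makes the solutions Cauchy, and
`V` is closed. -/
theorem mem_regularSubspace_of_finite_sdiff {s : Set ℂ} (hs : ({z : ℂ | ‖z‖ < 1} \ s).Finite)
    {x : H} (h : ∀ z ∈ s, ‖z‖ < 1 → ∃ f, (f, x + z • f) ∈ V) : x ∈ regularSubspace V := by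
  intro z₀ hz₀
  obtain ⟨r, hzr, hr⟩ := exists_between hz₀
  have hr0 : 0 ≤ r := (norm_nonneg _).trans hzr.le
  have hcl : z₀ ∈ closure ({z : ℂ | ‖z‖ < r} ∩ s) :=
    (isOpen_lt continuous_norm continuous_const).inter_closure
      ⟨hzr, mem_closure_of_finite_sdiff hs hz₀⟩
  obtain ⟨z, hz, hzlim⟩ := mem_closure_iff_seq_limit.1 hcl
  have hzr' : ∀ n, ‖z n‖ ≤ r := fun n => (show ‖z n‖ < r from (hz n).1).le
  choose f hf using fun n => h (z n) (hz n).2 ((hzr' n).trans_lt hr)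
  obtain ⟨K, hK0, hK⟩ := exists_lipschitz_bound hJ hV hev hr0 hr x
  have hcauchy : CauchySeq f := by
    rw [Metric.cauchySeq_iff]
    intro ε hε
    obtain ⟨N, hN⟩ := Metric.cauchySeq_iff.1 hzlim.cauchySeq (ε / (K + 1)) (by positivity)
    refine ⟨N, fun m hm n hn => ?_⟩
    have h1 := hN m hm n hn
    rw [dist_eq_norm, lt_div_iff₀ (by positivity)] at h1
    rw [dist_eq_norm]
    refine (hK _ _ _ _ (hzr' m) (hzr' n) (hf m) (hf n)).trans_lt ?_
    nlinarith [norm_nonneg (z m - z n)]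
  obtain ⟨f₀, hf₀⟩ := cauchySeq_tendsto_of_complete hcauchy
  exact ⟨f₀, hV.closed.mem_of_tendsto
    (hf₀.prodMk_nhds (tendsto_const_nhds.add (hzlim.smul hf₀))) (Eventually.of_forall hf)⟩

omit [CompleteSpace H] hJ hV hev in
theorem smul_resolventVec {x : H} (hx : x ∈ regularSubspace V) {z w : ℂ} (hz : ‖z‖ < 1)
    (hw : ‖w‖ < 1) (hzw : z ≠ w) :
    ((z - w)⁻¹ • (resolventVec V x z - resolventVec V x w),
      resolventVec V x w + z • (z - w)⁻¹ • (resolventVec V x z - resolventVec V x w)) ∈ V := by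
  have h := V.smul_mem (z - w)⁻¹
    (smul_mem_of_sub_mem (resolventVec_mem hx hz) (resolventVec_mem hx hw))
  rw [Prod.smul_mk, smul_add, smul_smul, inv_mul_cancel₀ (sub_ne_zero.2 hzw), one_smul,
    smul_comm] at h
  exact h

/-- For `z ≠ w` the divided difference of the solutions at `z` and `w` does the job; the single
point `z = w` is filled in by closedness. -/
theorem resolventVec_mem_regularSubspace {x : H} (hx : x ∈ regularSubspace V) {w : ℂ}
    (hw : ‖w‖ < 1) : resolventVec V x w ∈ regularSubspace V := by
  refine mem_regularSubspace_of_finite_sdiff hJ hV hev (s := {w}ᶜ)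
    ((Set.finite_singleton w).subset fun z hz => by simpa using hz.2) fun z hzw hz => ?_
  exact ⟨_, smul_resolventVec hx hz hw hzw⟩

theorem continuousAt_resolventVec {x : H} (hx : x ∈ regularSubspace V) {w : ℂ}
    (hw : ‖w‖ < 1) : ContinuousAt (resolventVec V x) w := by
  obtain ⟨r, hwr, hr⟩ := exists_between hw
  obtain ⟨K, hK0, hK⟩ :=
    exists_lipschitz_bound hJ hV hev ((norm_nonneg _).trans hwr.le) hr x
  refine continuousAt_of_locally_lipschitz (r := r - ‖w‖) (by linarith) K fun z hz => ?_
  rw [dist_eq_norm] at hz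
  have hzr : ‖z‖ ≤ r := by
    have := norm_sub_norm_le z w
    linarith
  rw [dist_eq_norm, dist_eq_norm]
  exact hK z w _ _ hzr hwr.le (resolventVec_mem hx (hzr.trans_lt hr)) (resolventVec_mem hx hw)

theorem differentiableAt_resolventVec {x : H} (hx : x ∈ regularSubspace V) {w : ℂ}
    (hw : ‖w‖ < 1) : DifferentiableAt ℂ (resolventVec V x) w := by
  have hxw := resolventVec_mem_regularSubspace hJ hV hev hx hw
  -- The difference quotient is itself the solution for the right side `resolventVec V x w`, hence
  -- continuous in `z`.
  have : HasDerivAt (resolventVec V x) (resolventVec V (resolventVec V x w) w) w := by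
    rw [hasDerivAt_iff_tendsto_slope]
    refine ((continuousAt_resolventVec hJ hV hev hxw hw).tendsto.mono_left
      nhdsWithin_le_nhds).congr' ?_
    have hnear : ∀ᶠ z in 𝓝[≠] w, ‖z‖ < 1 := nhdsWithin_le_nhds
      ((isOpen_lt continuous_norm continuous_const).mem_nhds hw)
    filter_upwards [hnear, self_mem_nhdsWithin] with z hz hzw
    rw [slope_def_module]
    exact (eq_resolventVec hev (smul_resolventVec hx hz hw hzw)).symm
  exact this.differentiableAt

theorem exists_re_indef_resolventVec_le {x : H} (hx : x ∈ regularSubspace V) {r : ℝ}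
    (hr0 : 0 < r) (hr1 : r < 1) :
    ∃ z : ℂ, ‖z‖ = r ∧
      (1 - r ^ 2) * (indef J (resolventVec V x z) (resolventVec V x z)).re ≤ (indef J x x).re := by
  -- Holomorphic in the disk, with real part `(1 - |z|²) [R x, R x]` by isometry and value `[x, x]`
  -- at `0`. The maximum principle for `exp (-ψ)` then finds a point on the circle where `Re ψ` is
  -- at most `Re ψ(0)`.
  let ψ : ℂ → ℂ := fun z => indef J (x + (2 * z) • resolventVec V x z) x
  have hψ : ∀ z, ‖z‖ < 1 →
      (ψ z).re = (1 - ‖z‖ ^ 2) * (indef J (resolventVec V x z) (resolventVec V x z)).re := by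
    intro z hz
    rw [hV.re_indef_eq hJ (resolventVec_mem hx hz)]
    have : ψ z = indef J x x + ((2 : ℝ) : ℂ) * (z * indef J (resolventVec V x z) x) := by
      simp only [ψ, indef, map_add, map_smul, inner_add_right, inner_smul_right]
      push_cast
      ring
    rw [this, Complex.add_re, Complex.re_ofReal_mul]
  have hdiff : ∀ z : ℂ, ‖z‖ < 1 → DifferentiableAt ℂ (fun z => Complex.exp (-ψ z)) z := by
    intro z hz
    have h1 := differentiableAt_resolventVec hJ hV hev hx hz
    have h2 : DifferentiableAt ℂ (fun z => x + (2 * z) • resolventVec V x z) z := by fun_prop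
    have h3 : DifferentiableAt ℂ ψ z :=
      ((innerSL ℂ x ∘L J).differentiableAt).comp z h2
    exact h3.neg.cexp
  have hd : DiffContOnCl ℂ (fun z => Complex.exp (-ψ z)) (Metric.ball 0 r) := by
    refine DifferentiableOn.diffContOnCl fun z hz => (hdiff z ?_).differentiableWithinAt
    rw [closure_ball _ hr0.ne', mem_closedBall_zero_iff] at hz
    exact hz.trans_lt hr1
  obtain ⟨z, hz, hmax⟩ := Complex.exists_mem_frontier_isMaxOn_norm Metric.isBounded_ball
    ⟨0, Metric.mem_ball_self hr0⟩ hd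
  rw [frontier_ball _ hr0.ne', mem_sphere_zero_iff_norm] at hz
  have h0 := hmax (subset_closure (Metric.mem_ball_self hr0))
  simp only [Set.mem_ofPred_eq, Function.comp_apply, Complex.norm_exp, Real.exp_le_exp,
    Complex.neg_re, neg_le_neg_iff] at h0
  refine ⟨z, hz, ?_⟩
  rw [hψ z (hz.trans_lt hr1), hz] at h0
  simpa [ψ] using h0

/-- The form is nonnegative on the intersection of the ranges of `V - z I`. -/
theorem re_indef_nonneg_of_mem_regularSubspace {x : H} (hx : x ∈ regularSubspace V) :
    0 ≤ (indef J x x).re := by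
  by_contra! hneg
  set c := -(indef J x x).re with hc
  have hc0 : 0 < c := by linarith
  have hex : ∀ n : ℕ, ∃ z : ℂ, ‖z‖ < 1 ∧
      (indef J (resolventVec V x z) (resolventVec V x z)).re ≤ -((n : ℝ) + 1) := by
    intro n
    -- On radius `1 - s` one has `1 - (1 - s)² ≤ 2 s ≤ c / (n + 1)`, so the form at the solution is
    -- at most `-(n + 1)`; the cap `1/2` keeps the radius positive.
    set s : ℝ := min (1 / 2) (c / (2 * (n + 1))) with hs
    have hn : (0 : ℝ) < n + 1 := by positivity
    have hs0 : 0 < s := lt_min (by norm_num) (by positivity)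
    have hs1 : s ≤ 1 / 2 := min_le_left _ _
    have hs2 : s * (2 * (n + 1)) ≤ c := by
      rw [← le_div_iff₀ (by positivity)]; exact min_le_right _ _
    obtain ⟨z, hz, hle⟩ := exists_re_indef_resolventVec_le hJ hV hev hx
      (r := 1 - s) (by linarith) (by linarith)
    refine ⟨z, by rw [hz]; linarith, ?_⟩
    by_contra! hgt
    have h1 : 0 < 1 - (1 - s) ^ 2 := by nlinarith
    have h2 := mul_lt_mul_of_pos_left hgt h1
    have h3 : (1 - (1 - s) ^ 2) * (n + 1) ≤ c := by nlinarith
    linarith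
  choose z hz hzn using hex
  have hnorm : ∀ n : ℕ, (n : ℝ) + 1 ≤ ‖negProj J (resolventVec V x (z n))‖ ^ 2 ∧
      ‖resolventVec V x (z n)‖ ^ 2 ≤ 2 * ‖negProj J (resolventVec V x (z n))‖ ^ 2 := by
    intro n
    have h1 := hzn n
    have h2 := hJ.norm_sq_eq_add (resolventVec V x (z n))
    rw [hJ.re_indef_self] at h1
    have hn : (0 : ℝ) ≤ n := n.cast_nonneg
    constructor
    · nlinarith [sq_nonneg ‖posProj J (resolventVec V x (z n))‖]
    · linarith
  have hbig : ∀ n : ℕ, (n : ℝ) + 1 ≤ ‖resolventVec V x (z n)‖ ^ 2 := by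
    intro n
    rw [hJ.norm_sq_eq_add]
    nlinarith [(hnorm n).1, sq_nonneg ‖posProj J (resolventVec V x (z n))‖]
  have hpos : ∀ n, 0 < ‖resolventVec V x (z n)‖ := by
    intro n
    have h1 := hbig n
    have hn : (0 : ℝ) ≤ n := n.cast_nonneg
    by_contra! h
    have : ‖resolventVec V x (z n)‖ = 0 := le_antisymm h (norm_nonneg _)
    rw [this] at h1
    norm_num at h1
    linarith
  have htop : Tendsto (fun n => ‖resolventVec V x (z n)‖) atTop atTop := by
    have h1 : Tendsto (fun n : ℕ => ‖resolventVec V x (z n)‖ ^ 2) atTop atTop :=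
      tendsto_atTop_mono (fun n => (by linarith [hbig n] : (n : ℝ) ≤ _))
        tendsto_natCast_atTop_atTop
    refine tendsto_atTop.2 fun b => ?_
    filter_upwards [tendsto_atTop.1 h1 (b ^ 2)] with n hn
    exact abs_le_of_sq_le_sq' hn (norm_nonneg _) |>.2
  -- The solutions blow up while the right side `x` stays fixed, and their negative part dominates,
  -- so `V` would have an eigenvector.
  obtain ⟨z₀, e, he, heV⟩ := hJ.exists_eigenvector hV.closed (f := fun n => resolventVec V x (z n))
    (g := fun _ => x) (z := z) (fun n => resolventVec_mem hx (hz n)) (fun n => (hz n).le)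
    (fun n => norm_pos_iff.1 (hpos n)) (htop.const_div_atTop _)
    (fun n => by nlinarith [(hnorm n).2, sq_nonneg ‖negProj J (resolventVec V x (z n))‖])
  exact he (hev z₀ e heV)

/-- Neutral vectors of a nonnegative form are a subspace, here of finite dimension because `negProj
J` is injective on it. The inverse of `V` maps it into itself, so a nonzero one would contain an
eigenvector. -/
theorem eq_zero_of_re_indef_eq_zero {x : H} (hx : x ∈ regularSubspace V)
    (hx0 : (indef J x x).re = 0) : x = 0 := by
  have hadd : ∀ a b : H, (indef J (a + b) (a + b)).re =
      (indef J a a).re + (indef J b b).re + 2 * (indef J a b).re := by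
    intro a b
    have h1 : indef J (a + b) (a + b) =
        indef J a a + indef J b b + (indef J a b + conj (indef J a b)) := by
      rw [hJ.indef_conj]
      simp only [indef, map_add, inner_add_left, inner_add_right]
      ring
    rw [h1]
    simp only [Complex.add_re, Complex.conj_re]
    ring
  have hsmul : ∀ (c : ℂ) (a : H), (indef J (c • a) (c • a)).re = ‖c‖ ^ 2 * (indef J a a).re := by
    intro c a
    rw [hJ.re_indef_self, hJ.re_indef_self, map_smul, map_smul, norm_smul, norm_smul]
    ring
  have hnonneg := fun a (ha : a ∈ regularSubspace V) =>
    re_indef_nonneg_of_mem_regularSubspace hJ hV hev ha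
  let N : Submodule ℂ H :=
    { carrier := {a | a ∈ regularSubspace V ∧ (indef J a a).re = 0}
      zero_mem' := ⟨Submodule.zero_mem _, by simp [indef]⟩
      add_mem' := by
        rintro a b ⟨ha, ha0⟩ ⟨hb, hb0⟩
        refine ⟨Submodule.add_mem _ ha hb, ?_⟩
        have h1 := hnonneg _ (Submodule.add_mem _ ha hb)
        -- Nonnegativity at `a + b` and at `a - b` forces the real cross term to vanish.
        have h2 := hnonneg _ (Submodule.add_mem _ ha (Submodule.smul_mem _ (-1) hb))
        have h3 : indef J a ((-1 : ℂ) • b) = -indef J a b := by simp [indef]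
        rw [hadd, hsmul, h3, Complex.neg_re] at h2
        rw [hadd] at h1 ⊢
        rw [ha0, hb0] at h1 h2 ⊢
        linarith
      smul_mem' := by
        rintro c a ⟨ha, ha0⟩
        exact ⟨Submodule.smul_mem _ c ha, by rw [hsmul, ha0, mul_zero]⟩ }
  have := hJ.finite_neg
  let P : N →ₗ[ℂ] LinearMap.ker ((J + 1 : H →L[ℂ] H) : H →ₗ[ℂ] H) :=
    ((negProj J : H →ₗ[ℂ] H) ∘ₗ N.subtype).codRestrict _ fun c => hJ.negProj_mem c
  have hP : Function.Injective P := by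
    rw [← LinearMap.ker_eq_bot, LinearMap.ker_eq_bot']
    intro a ha
    have h1 : negProj J (a : H) = 0 := congrArg Subtype.val ha
    have h2 := a.2.2
    have h3 := hJ.norm_sq_eq_add (a : H)
    rw [hJ.re_indef_self] at h2
    rw [h1, norm_zero] at h2 h3
    have h4 : ‖(a : H)‖ ^ 2 = 0 := by linarith
    exact Subtype.ext (norm_eq_zero.1 (pow_eq_zero_iff two_ne_zero |>.1 h4))
  have : FiniteDimensional ℂ N := FiniteDimensional.of_injective P hP
  have hsol : ∀ a : H, a ∈ regularSubspace V → (resolventVec V a 0, a) ∈ V := by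
    intro a ha
    simpa using resolventVec_mem ha (z := 0) (by simp)
  have huniq : ∀ a f : H, (f, a) ∈ V → f = resolventVec V a 0 := fun a f hf =>
    eq_resolventVec hev (by simpa using hf)
  let G : N →ₗ[ℂ] N :=
    { toFun := fun a => ⟨resolventVec V a 0,
        resolventVec_mem_regularSubspace hJ hV hev a.2.1 (by simp), by
          rw [← hV.isometric _ _ (hsol a a.2.1)]; exact a.2.2⟩
      map_add' := fun a b => Subtype.ext
        (huniq _ _ (V.add_mem (hsol a a.2.1) (hsol b b.2.1))).symm
      map_smul' := fun c a => Subtype.ext (huniq _ _ (V.smul_mem c (hsol a a.2.1))).symm }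
  by_contra hne
  have : Nontrivial N := ⟨⟨x, hx, hx0⟩, 0, fun h => hne (congrArg Subtype.val h)⟩
  obtain ⟨μ, hμ⟩ := Module.End.exists_eigenvalue G
  obtain ⟨a, ha⟩ := hμ.exists_hasEigenvector
  have h1 : (μ • (a : H), (a : H)) ∈ V := by
    have h2 : resolventVec V (a : H) 0 = μ • (a : H) := congrArg Subtype.val ha.apply_eq_smul
    rw [← h2]
    exact hsol a a.2.1
  have ha0 : (a : H) ≠ 0 := fun h => ha.2 (Subtype.ext h)
  -- Eigenvalue `0` of the inverse contradicts single-valuedness of `V`; otherwise `μ⁻¹` is an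
  -- eigenvalue of `V`.
  by_cases hμ0 : μ = 0
  · rw [hμ0, zero_smul, ← mem_mulRel, hV.singleValued] at h1
    exact ha0 h1
  · have h2 := hev μ⁻¹ (μ • (a : H)) (by rwa [smul_smul, inv_mul_cancel₀ hμ0, one_smul])
    exact ha0 ((smul_eq_zero.1 h2).resolve_left hμ0)

end RegularSubspace

/-! ### Exactly `κ` negative squares for simple `V` -/

section SimpleCase

variable {H L₁ L₂ : Type*}
  [NormedAddCommGroup H] [InnerProductSpace ℂ H] [CompleteSpace H]
  [NormedAddCommGroup L₁] [InnerProductSpace ℂ L₁] [CompleteSpace L₁]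
  [NormedAddCommGroup L₂] [InnerProductSpace ℂ L₂] [CompleteSpace L₂]
  {J : H →L[ℂ] H} {κ : ℕ} {V : Submodule ℂ (H × H)} {Γ : Submodule ℂ ((H × H) × (L₁ × L₂))}
  {A : H →L[ℂ] H} {B : L₁ →L[ℂ] H} {C : H →L[ℂ] L₂} {D : L₁ →L[ℂ] L₂}

/-- A dense subspace contains negative vectors along a `κ`-dimensional parameter space. -/
theorem IsPontryaginSymmetry.exists_negative_of_dense (hJ : IsPontryaginSymmetry J κ)
    {Y : Submodule ℂ H} (hY : Y.topologicalClosure = ⊤) :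
    ∃ y : Fin κ → H, (∀ i, y i ∈ Y) ∧ ∀ c : Fin κ → ℂ, c ≠ 0 →
      (indef J (∑ i, c i • y i) (∑ i, c i • y i)).re < 0 := by
  have := hJ.finite_neg
  let N := LinearMap.ker ((J + 1 : H →L[ℂ] H) : H →ₗ[ℂ] H)
  let b : OrthonormalBasis (Fin κ) ℂ N :=
    (stdOrthonormalBasis ℂ N).reindex (finCongr hJ.finrank_neg)
  -- With `‖c i‖ ≤ ‖h‖`, the `κ` errors add up to at most `‖h‖ / 4`: the positive part stays below
  -- `‖h‖ / 4`, the negative part above `3 ‖h‖ / 4`. The `+ 1` covers `κ = 0`.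
  have hdense : ∀ i, ∃ y ∈ Y, ‖y - b i‖ < 1 / (4 * ((κ : ℝ) + 1)) := by
    intro i
    have hmem : (b i : H) ∈ closure (Y : Set H) := by
      rw [← Submodule.topologicalClosure_coe, hY]; trivial
    obtain ⟨y, hy, hd⟩ := Metric.mem_closure_iff.1 hmem (1 / (4 * ((κ : ℝ) + 1))) (by positivity)
    exact ⟨y, hy, by rwa [dist_comm, dist_eq_norm] at hd⟩
  choose y hyY hy using hdense
  refine ⟨y, hyY, fun c hc => ?_⟩
  set h : N := ∑ i, c i • b i with hh
  set d : H := ∑ i, c i • (y i - b i) with hd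
  have hsum : ∑ i, c i • y i = (h : H) + d := by
    rw [hh, hd, Submodule.coe_sum, ← Finset.sum_add_distrib]
    exact Finset.sum_congr rfl fun i _ => by rw [Submodule.coe_smul]; module
  have hrepr : ∀ i, b.repr h i = c i := fun i => by
    have : h = b.repr.symm (WithLp.toLp 2 c) := by rw [hh, b.sum_repr_symm]
    rw [this, LinearIsometryEquiv.apply_symm_apply]
  have hcle : ∀ i, ‖c i‖ ≤ ‖(h : H)‖ := fun i => by
    have h1 := norm_inner_le_norm (𝕜 := ℂ) (b i) h
    rw [← b.repr_apply_apply, hrepr, b.orthonormal.1 i, one_mul] at h1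
    exact h1
  have hhpos : 0 < ‖(h : H)‖ := by
    obtain ⟨i, hi⟩ := Function.ne_iff.1 hc
    exact (norm_pos_iff.2 hi).trans_le (hcle i)
  have hdle : ‖d‖ ≤ ‖(h : H)‖ / 4 := by
    calc ‖d‖ ≤ ∑ i, ‖c i • (y i - b i)‖ := norm_sum_le _ _
      _ ≤ ∑ _i : Fin κ, ‖(h : H)‖ * (1 / (4 * ((κ : ℝ) + 1))) := by
          refine Finset.sum_le_sum fun i _ => ?_
          rw [norm_smul]
          exact mul_le_mul (hcle i) (hy i).le (norm_nonneg _) (norm_nonneg _)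
      _ = ‖(h : H)‖ / 4 * (κ / (κ + 1)) := by
          rw [Finset.sum_const, Finset.card_univ, Fintype.card_fin, nsmul_eq_mul]
          field_simp
      _ ≤ ‖(h : H)‖ / 4 * 1 := by
          refine mul_le_mul_of_nonneg_left ?_ (by positivity)
          rw [div_le_one (by positivity)]
          linarith
      _ = _ := mul_one _
  have hneg : negProj J (h : H) = h := (negProj_eq_self_iff _).2 h.2
  have hpos : posProj J (h : H) = 0 := by rw [posProj_eq, hneg, sub_self]
  have hd2 := hJ.norm_sq_eq_add d
  have hp1 : ‖posProj J d‖ ≤ ‖d‖ :=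
    (sq_le_sq₀ (norm_nonneg _) (norm_nonneg _)).1 (by nlinarith [sq_nonneg ‖negProj J d‖])
  have hn1 : ‖negProj J d‖ ≤ ‖d‖ :=
    (sq_le_sq₀ (norm_nonneg _) (norm_nonneg _)).1 (by nlinarith [sq_nonneg ‖posProj J d‖])
  rw [hsum, hJ.re_indef_self, map_add, map_add, hneg, hpos, zero_add]
  have hn2 : ‖(h : H)‖ - ‖negProj J d‖ ≤ ‖(h : H) + negProj J d‖ := by
    have := norm_sub_norm_le (h : H) (-negProj J d)
    rwa [norm_neg, sub_neg_eq_add] at this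
  nlinarith [norm_nonneg (posProj J d), norm_nonneg (negProj J d)]

namespace IsScatteringBlock

variable (hJ : IsPontryaginSymmetry J κ) (hV : IsClosedIsometricOperator J V)
  (hΓ : IsUnitaryBoundaryPair J V Γ) (hS : IsScatteringBlock J Γ A B C D)

-- Green's identity for `(z̄ g, g)` and `(f, x + z f) ∈ V`: the terms with `f` cancel and the
-- boundary terms vanish.
include hJ hΓ hS in
theorem indef_gammaDual_eq_zero {x : H} (hx : x ∈ regularSubspace V) {z : ℂ}
    (hz : z ∈ innerDomain Γ) (u : L₂) : indef J (gammaDual J A C z u) x = 0 := by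
  obtain ⟨f, hf⟩ := hx z hz.2
  have h := hΓ.indef_sub (gammaDual_mem hJ hΓ hS hz u) ((hΓ.mem_iff _ _).1 hf)
  simp only [indef, map_smul, inner_add_left, inner_smul_left, inner_smul_right,
    inner_zero_left] at h
  rw [indef]
  linear_combination -h

-- Converse direction. Let `y` solve the adjoint pencil equation with right side `J x`.
-- Orthogonality says `C y = 0`, so the coordinates `(y, A y)` with zero boundary values describe an
-- element of `V`, and unwinding them gives the right side `x`.
include hJ hΓ hS in
theorem exists_mem_of_orthogonal {x : H} {z : ℂ} (hz : z ∈ innerDomain Γ)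
    (hx : ∀ u : L₂, indef J x (gammaDual J A C z u) = 0) : ∃ f, (f, x + z • f) ∈ V := by
  set A' := ContinuousLinearMap.adjoint A
  have hunit := isUnit_pencil_adjoint hJ hΓ hS hz
  set y := ContinuousLinearMap.adjoint (Ring.inverse (pencil J A' (conj z))) (J x) with hy
  have hC : C y = 0 := by
    refine ext_inner_left ℂ fun u => ?_
    rw [inner_zero_right, ← ContinuousLinearMap.adjoint_inner_left, hy,
      ContinuousLinearMap.adjoint_inner_right]
    exact hx u
  have hpen : posProj J y + z • negProj J y - (z • posProj J (A y) + negProj J (A y)) = J x := by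
    refine ext_inner_left ℂ fun v => ?_
    have h1 : inner ℂ (Ring.inverse (pencil J A' (conj z)) (pencil J A' (conj z) v)) (J x) =
        inner ℂ v (J x) := by rw [inverse_pencil_apply hunit]
    rw [← ContinuousLinearMap.adjoint_inner_right, ← hy, pencil_apply] at h1
    rw [← h1]
    simp only [inner_add_left, inner_sub_left, inner_sub_right, inner_add_right, inner_smul_left,
      inner_smul_right, Complex.conj_conj, A', ContinuousLinearMap.adjoint_inner_left,
      hJ.inner_posProj_left, hJ.inner_negProj_left]
  refine ⟨posProj J (A y) + negProj J y, (hΓ.mem_iff _ _).2 ?_⟩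
  have hmem := (hS.mem_iff_of_coords hJ y (A y) 0 0).2 (by simp [hC])
  convert hmem using 3
  rw [← hJ.apply_apply x, ← hpen]
  simp only [map_sub, map_add, map_smul, ← posProj_sub_negProj J, hJ.posProj_posProj,
    hJ.posProj_negProj, hJ.negProj_posProj, hJ.negProj_negProj]
  module

include hJ hV hΓ hS in
theorem hasNegSquares_of_isSimpleIsometric (hsimple : IsSimpleIsometric J V) :
    HasNegSquares κ (transferFun J A B C D) (innerDomain Γ) := by
  have hev : ∀ (z : ℂ) (e : H), (e, z • e) ∈ V → e = 0 := fun z e he =>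
    hsimple.eq_zero_of_mem hJ he
  set X := ⨆ z ∈ innerDomain Γ, LinearMap.range (gammaDual J A C z : L₂ →ₗ[ℂ] H) with hX
  have hXmem : ∀ z ∈ innerDomain Γ, ∀ u, gammaDual J A C z u ∈ X := fun z hz u =>
    le_iSup₂_of_le (f := fun z (_ : z ∈ innerDomain Γ) =>
      LinearMap.range (gammaDual J A C z : L₂ →ₗ[ℂ] H)) z hz le_rfl ⟨u, rfl⟩
  have horth : ∀ n ∈ regularSubspace V, ∀ x ∈ X, indef J x n = 0 := by
    intro n hn
    have hle : X ≤ (ℂ ∙ J n)ᗮ := by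
      refine iSup₂_le fun z hz => ?_
      rintro _ ⟨u, rfl⟩
      rw [Submodule.mem_orthogonal_singleton_iff_inner_right, hJ.inner_J_left]
      exact indef_gammaDual_eq_zero hJ hΓ hS hn hz u
    intro x hx
    have := Submodule.mem_orthogonal_singleton_iff_inner_right.1 (hle hx)
    rwa [hJ.inner_J_left] at this
  -- If `y` is orthogonal to both summands, then `J y` lies in `regularSubspace V` and is orthogonal
  -- to it in the form, hence neutral, hence zero.
  have hclosure : (X ⊔ regularSubspace V).topologicalClosure = ⊤ := by
    rw [Submodule.topologicalClosure_eq_top_iff, Submodule.eq_bot_iff]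
    intro y hy
    have hyY : ∀ g ∈ X ⊔ regularSubspace V, indef J (J y) g = 0 := fun g hg => by
      rw [indef, hJ.apply_apply]
      exact hy g hg
    have hreg : J y ∈ regularSubspace V :=
      mem_regularSubspace_of_finite_sdiff hJ hV hev (finite_sdiff_innerDomain hJ hV hΓ hS)
        fun z hz _ => exists_mem_of_orthogonal hJ hΓ hS hz fun u =>
          hyY _ (Submodule.mem_sup_left (hXmem z hz u))
    have h0 := eq_zero_of_re_indef_eq_zero hJ hV hev hreg
      (by rw [hyY _ (Submodule.mem_sup_right hreg), Complex.zero_re])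
    rw [← hJ.apply_apply y, h0, map_zero]
  obtain ⟨y, hyY, hneg⟩ := hJ.exists_negative_of_dense hclosure
  choose x hx n hn hxn using fun i => Submodule.mem_sup.1 (hyY i)
  refine hasNegSquares_of_negative_span hJ hΓ hS x hx fun c hc => ?_
  set x' := ∑ i, c i • x i
  set n' := ∑ i, c i • n i
  have hx' : x' ∈ X := Submodule.sum_mem _ fun i _ => X.smul_mem _ (hx i)
  have hn' : n' ∈ regularSubspace V := Submodule.sum_mem _ fun i _ => Submodule.smul_mem _ _ (hn i)
  have hsum : ∑ i, c i • y i = x' + n' := by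
    simp only [x', n', ← Finset.sum_add_distrib, ← smul_add, hxn]
  have h1 := hneg c hc
  -- The cross terms vanish and `[n', n'] ≥ 0`, so negativity passes from `x' + n'` to `x'`.
  have h2 : indef J (x' + n') (x' + n') = indef J x' x' + indef J n' n' +
      (indef J x' n' + conj (indef J x' n')) := by
    rw [hJ.indef_conj]
    simp only [indef, map_add, inner_add_left, inner_add_right]
    ring
  rw [hsum, h2, horth n' hn' x' hx', map_zero, add_zero, add_zero, Complex.add_re] at h1
  linarith [re_indef_nonneg_of_mem_regularSubspace hJ hV hev hn']

end IsScatteringBlock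

end SimpleCase

end BoundaryPair

end

theorem mainTheorem1
    {H L₁ L₂ : Type*}
    [NormedAddCommGroup H] [InnerProductSpace ℂ H] [CompleteSpace H]
    [NormedAddCommGroup L₁] [InnerProductSpace ℂ L₁] [CompleteSpace L₁]
    [NormedAddCommGroup L₂] [InnerProductSpace ℂ L₂] [CompleteSpace L₂]
    (J : H →L[ℂ] H) (κ : ℕ) (hJ : IsPontryaginSymmetry J κ)
    (V : Submodule ℂ (H × H)) (hV : IsClosedIsometricOperator J V)
    (Γ : Submodule ℂ ((H × H) × (L₁ × L₂))) (hΓ : IsUnitaryBoundaryPair J V Γ) :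
    -- the extensions `V₁`, `V₂` and the sets `D`, `D_e`
    (IsClosed (ext₁ Γ : Set (H × H)) ∧ IsClosed (ext₂ Γ : Set (H × H)) ∧
      ext₁ Γ = invRel (adjRel J (ext₂ Γ)) ∧
      innerDomain Γ = {z : ℂ | ‖z‖ < 1} \ pointSpectrum (ext₁ Γ) ∧
      outerDomain Γ = {z : ℂ | 1 < ‖z‖} \ pointSpectrum (ext₂ Γ) ∧
      outerDomain Γ = {z : ℂ | 1 < ‖z‖ ∧ 1 / conj z ∈ innerDomain Γ} ∧
      (innerDomain Γ).Nonempty ∧ (outerDomain Γ).Nonempty ∧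
      ({z : ℂ | ‖z‖ < 1} \ innerDomain Γ).encard ≤ κ ∧
      ({z : ℂ | 1 < ‖z‖} \ outerDomain Γ).encard ≤ κ) ∧
    IsOpen (innerDomain Γ) ∧ IsOpen (outerDomain Γ) ∧
    -- the γ-fields and the Weyl function are bounded everywhere defined operators
    ∃ (γ₁ : ℂ → L₁ →L[ℂ] H) (γ₂ : ℂ → L₂ →L[ℂ] H) (Θ : ℂ → L₁ →L[ℂ] L₂),
      (∀ z ∈ innerDomain Γ, (γ₁ z : L₁ →ₗ[ℂ] H).graph = gammaRel₁ Γ z) ∧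
      (∀ z ∈ outerDomain Γ, (γ₂ z : L₂ →ₗ[ℂ] H).graph = gammaRel₂ Γ z) ∧
      (∀ z ∈ innerDomain Γ, (Θ z : L₁ →ₗ[ℂ] L₂).graph = weylRel Γ z) ∧
      -- the γ-fields are holomorphic
      DifferentiableOn ℂ γ₁ (innerDomain Γ) ∧
      DifferentiableOn ℂ γ₂ (outerDomain Γ) ∧
      -- behaviour of `γ₂^#(z) = γ₂(1 / z̄)^[*]` at the origin
      ((0 : ℂ) ∈ innerDomain Γ →
        Tendsto (fun z : ℂ => pontAdjoint J (γ₂ (conj z)⁻¹)) (𝓝[≠] 0) (𝓝 0) ∧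
        ∃ G : H →L[ℂ] L₂,
          Tendsto (fun z : ℂ => z⁻¹ • pontAdjoint J (γ₂ (conj z)⁻¹)) (𝓝[≠] 0) (𝓝 G)) ∧
      -- the Weyl function is holomorphic and of generalized Schur class
      DifferentiableOn ℂ Θ (innerDomain Γ) ∧
      (∃ κ' ≤ κ, IsGenSchur κ' Θ (innerDomain Γ)) ∧
      (IsSimpleIsometric J V → IsGenSchur κ Θ (innerDomain Γ)) ∧
      -- the γ-fields and the Weyl function describe `Γ` on the eigenvectors
      (∀ z ∈ innerDomain Γ, ∀ u₁ : L₁, ((γ₁ z u₁, z • γ₁ z u₁), (u₁, Θ z u₁)) ∈ Γ) ∧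
      (∀ z ∈ outerDomain Γ, ∀ u₂ : L₂,
        ((γ₂ z u₂, z • γ₂ z u₂), (ContinuousLinearMap.adjoint (Θ (1 / conj z)) u₂, u₂)) ∈ Γ) ∧
      -- resolvent-type identities
      (∀ z ∈ innerDomain Γ, ∀ w ∈ innerDomain Γ,
        γ₁ z = γ₁ w + (z - w) • (resolventRel (ext₁ Γ) z ∘L γ₁ w)) ∧
      (∀ z ∈ outerDomain Γ, ∀ w ∈ outerDomain Γ,
        γ₂ z = γ₂ w + (z - w) • (resolventRel (ext₂ Γ) z ∘L γ₂ w)) := by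
  obtain ⟨A, B, C, D, hS⟩ := hΓ.exists_isScatteringBlock hJ
  refine ⟨⟨hS.isClosed_ext₁, hS.isClosed_ext₂, hS.ext₁_eq_invRel_adjRel_ext₂ hJ,
    hS.innerDomain_eq_sdiff hJ hΓ, hS.outerDomain_eq_sdiff hJ hΓ, hS.outerDomain_eq hJ hΓ,
    hS.nonempty_innerDomain hJ hV hΓ, hS.nonempty_outerDomain hJ hV hΓ,
    hS.encard_sdiff_innerDomain_le hJ hV hΓ, hS.encard_sdiff_outerDomain_le hJ hV hΓ⟩,
    hS.isOpen_innerDomain hJ hΓ, hS.isOpen_outerDomain hJ hΓ,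
    gammaIn J A B, gammaOut J A C, transferFun J A B C D,
    fun _ => hS.graph_gammaIn hJ hΓ, fun _ => hS.graph_gammaOut hJ hΓ,
    fun _ => hS.graph_transferFun hJ hΓ, fun z hz => ?_, fun z hz => ?_,
    fun h0 => ⟨hS.tendsto_pontAdjoint_gammaOut hJ hΓ h0, _,
      hS.tendsto_inv_smul_pontAdjoint_gammaOut hJ hΓ h0⟩, fun z hz => ?_, ?_,
    fun hsimple => hS.isGenSchur_of_hasNegSquares hJ hΓ
      (hS.hasNegSquares_of_isSimpleIsometric hJ hV hΓ hsimple),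
    fun _ hz => hS.gammaIn_mem hJ hΓ hz, fun _ hz => hS.gammaOut_mem hJ hΓ hz,
    fun _ hz _ hw => hS.gammaIn_eq_add hJ hΓ hz hw,
    fun _ hz _ hw => hS.gammaOut_eq_add hJ hΓ hz hw⟩
  · exact (differentiableAt_gammaIn B
      ((hS.mem_innerDomain_iff hJ hΓ).1 hz).2).differentiableWithinAt
  · obtain ⟨h1, h2⟩ := (hS.mem_outerDomain_iff hJ hΓ).1 hz
    exact (differentiableAt_gammaOut C (norm_pos_iff.1 (by linarith)) h2).differentiableWithinAt
  · exact (differentiableAt_transferFun B C D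
      ((hS.mem_innerDomain_iff hJ hΓ).1 hz).2).differentiableWithinAt
  · obtain ⟨k, hk, h⟩ := exists_hasNegSquares_of_bounded
      (Θ := transferFun J A B C D) (Ω := innerDomain Γ)
      fun _ _ f hω => hS.negEigCount_schurGram_le hJ hΓ f hω
    exact ⟨k, hk, hS.isGenSchur_of_hasNegSquares hJ hΓ h⟩
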